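/- Let $\mathbb{K}$ be $\mathbb{R}$ or $\mathbb{C}$. Let $V_1,\dots,V_m$ ($m\ge 1$) be $2$-dimensional $\mathbb{K}$-vector spaces and write $V^*=V_1^*\otimes\cdots\otimes V_m^*$. A factorization structure of dimension $m$ is an injective linear map $\varphi:\mathfrak{h}\to V^*$ with $\dim\mathfrak{h}=m+1$ such that, for every $j$ and generic $\ell\in\mathbb{P}(V_j)$, the space $\varphi(\mathfrak h)\cap\Sigma^0_{j,\ell}$ is $1$-dimensional, where $\Sigma_{j,\ell}^0\subset V^*$ is the annihilator of $V_1\otimes\cdots\otimes\ell\otimes\cdots\otimes V_m$ ($\ell$ in the $j$-th slot). An isomorphism of $\varphi:\mathfrak h\to V_1^*\otimes\cdots\otimes V_m^*$ with $\varphi':\mathfrak h'\to V_1'^*\otimes\cdots\otimes V_m'^*$ is given by a linear isomorphism $\mathfrak h\to\mathfrak h'$, a permutation $\sigma$ of the slots and linear isomorphisms $V_{\sigma(j)}^*\to V_j'^*$, all compatible with $\varphi,\varphi'$. Let $m=d_1+\cdots+d_k$ be a partition into positive integers, let $W_1,\dots,W_k$ be $2$-dimensional, and let $\Gamma_j\subset\bigotimes_{r\ne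 j}(W_r^*)^{\otimes d_r}$ be $1$-dimensional subspaces such that $\sum_{j}\mathrm{ins}_j(S^{d_j}W_j^*\otimes\Gamma_j)\subset\bigotimes_r(W_r^*)^{\otimes d_r}$ has dimension $m+1$, where $S^{d}W^*\subset (W^*)^{\otimes d}$ is the space of symmetric tensors and $\mathrm{ins}_j$ puts the first factor into the $j$-th group of slots. The inclusion of this sum is called a standard Segre-Veronese factorization structure; it is a Segre one if all $d_j=1$, and the Veronese one $S^mW^*\subset (W^*)^{\otimes m}$ if $k=1$. It is decomposable if every $\Gamma_j$ is spanned by a tensor of the form $\bigotimes_{r\neq j}\bigotimes_{p=1}^{d_r}a_j^{r,p}$ with $a_j^{r,p}\in W_r^*$ nonzero. A decomposable Segre-Veronese factorization structure is a map isomorphic to a standard decomposable one. A decomposable Segre factorization structure $H\subset\bigotimes_{i=1}^k W_i^*$ (so $\dim H=k+1$) admits a full-product if $k=1$, or if, for some slot $j$, $H=\mathrm{ins}_j(q\otimes Q+W_j^*\otimes\Gamma)$ with a line $q\subset W_j^*$, a decomposable Segre factorization structure $Q$ on the remaining slots which itself admits a full-product, and a line $\Gamma\subset Q$. A decomposable Segre-Veronese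 factorization structure with partition $(d_r)$ and defining tensors $\Gamma_j=\bigotimes_{r\ne j}\langle a_j^r\rangle^{\otimes d_r}$ admits a full-product if the corresponding Segre structure $\sum_j\mathrm{ins}_j(W_j^*\otimes\bigotimes_{r\neq j}\langle a_j^r\rangle)$ is a decomposable Segre factorization structure (of dimension $k$) which admits a full-product. Iterated products of Veronese factorization structures are the members of the smallest class which contains the Veronese structures $S^dW^*\subset(W^*)^{\otimes d}$ ($d\ge1$, $\dim W=2$), is closed under isomorphism, and contains with $H$ and $K$ every product $H\otimes T+S\otimes K$, where $S\subset H$ and $T\subset K$ are lines spanned by decomposable tensors (a map is identified with its image). Theorem. Let $\varphi:\mathfrak h\to V_1^*\otimes\cdots\otimes V_m^*$ be a linear map. (i) If $\varphi$ is a decomposable Segre-Veronese factorization structure, then $\varphi$ is a factorization structure and it admits a full-product: it is isomorphic to a standard one with defining tensors of the form $\Gamma_j=\bigotimes_{r\ne j}\langle a_j^r\rangle^{\otimes d_r}$, and for every such presentation of $\varphi$ the corresponding Segre structure is a decomposable Segre factorization structure which admits a full-product. (ii) $\varphi$ is a decomposable Segre-Veronese factorization structure if and only if $\varphi$ is an iterated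 product of Veronese factorization structures. -/

import Mathlib

open Module
open scoped TensorProduct LinearAlgebra.Projectivization

universe u v w

namespace FactStr

noncomputable section

/-! ### Tensors indexed by slots

A tensor product `M₁ ⊗ ⋯ ⊗ M_m` is the Mathlib tensor product `⨂[𝕜] i : ι, M i` over a finite type
`ι` of slots, the number of slots being `m = Nat.card ι`. -/

section Tensors

variable (𝕜 : Type w) [Field 𝕜]

/-- `S^d U`, viewed as the subspace of symmetric tensors in `U ⊗ ⋯ ⊗ U` (slots `ι`): the tensors
fixed by all permutations of the slots. -/
def symTensors (ι : Type) (U : Type u) [AddCommGroup U] [Module 𝕜 U] :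
    Submodule 𝕜 (⨂[𝕜] _ : ι, U) where
  carrier := {t | ∀ σ : Equiv.Perm ι, PiTensorProduct.reindex 𝕜 (fun _ : ι => U) σ t = t}
  add_mem' := fun ha hb σ => by rw [map_add, ha σ, hb σ]
  zero_mem' := fun σ => map_zero _
  smul_mem' := fun c x hx σ => by rw [map_smul, hx σ]

variable {𝕜}

/-- A decomposable 1-dimensional subspace: the span of `f₁ ⊗ ⋯ ⊗ f_m` with all `f_i` nonzero,
i.e. the tensor product of the lines spanned by the `f_i`. -/
def IsDecomposableLine {ι : Type} {M : ι → Type u} [∀ i, AddCommGroup (M i)]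
    [∀ i, Module 𝕜 (M i)] (S : Submodule 𝕜 (⨂[𝕜] i, M i)) : Prop :=
  ∃ f : ∀ i, M i, (∀ i, f i ≠ 0) ∧ S = Submodule.span 𝕜 {PiTensorProduct.tprod 𝕜 f}

variable (𝕜)

/-- The canonical bilinear map `(⨂_α M) × (⨂_β M) → ⨂_{α ⊕ β} M`. -/
def tensorMul {α β : Type} (M : α ⊕ β → Type u) [∀ i, AddCommGroup (M i)]
    [∀ i, Module 𝕜 (M i)] :
    (⨂[𝕜] a, M (.inl a)) →ₗ[𝕜] (⨂[𝕜] b, M (.inr b)) →ₗ[𝕜] ⨂[𝕜] i, M i :=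
  TensorProduct.curry (PiTensorProduct.tmulEquivDep 𝕜 M).toLinearMap

/-- The canonical bilinear map which puts a tensor over `α` into the slots `e (inl a)` and a tensor
over `β` into the slots `e (inr b)`. -/
def tensorMerge {α β ι : Type} (e : α ⊕ β ≃ ι) (M : ι → Type u) [∀ i, AddCommGroup (M i)]
    [∀ i, Module 𝕜 (M i)] :
    (⨂[𝕜] a, M (e (.inl a))) →ₗ[𝕜] (⨂[𝕜] b, M (e (.inr b))) →ₗ[𝕜] ⨂[𝕜] i, M i :=
  (tensorMul 𝕜 (fun s => M (e s))).compr₂ (PiTensorProduct.reindex 𝕜 M e.symm).symm.toLinearMap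

theorem tensorMul_tprod {α β : Type} (M : α ⊕ β → Type u) [∀ i, AddCommGroup (M i)]
    [∀ i, Module 𝕜 (M i)] (f : ∀ i, M i) :
    tensorMul 𝕜 M (PiTensorProduct.tprod 𝕜 fun a => f (.inl a))
      (PiTensorProduct.tprod 𝕜 fun b => f (.inr b)) = PiTensorProduct.tprod 𝕜 f := by
  have h := PiTensorProduct.tmulEquivDep_apply (R := 𝕜) M (fun a => f (.inl a)) (fun b => f (.inr b))
  refine h.trans (congrArg _ (funext fun i => ?_))
  cases i <;> rfl

theorem tensorMerge_tprod {α β ι : Type} (e : α ⊕ β ≃ ι) (M : ι → Type u)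
    [∀ i, AddCommGroup (M i)] [∀ i, Module 𝕜 (M i)] (f : ∀ i, M i) :
    tensorMerge 𝕜 e M (PiTensorProduct.tprod 𝕜 fun a => f (e (.inl a)))
      (PiTensorProduct.tprod 𝕜 fun b => f (e (.inr b))) =
      PiTensorProduct.tprod 𝕜 f := by
  have h := tensorMul_tprod 𝕜 (fun s => M (e s)) (fun s => f (e s))
  have h2 := PiTensorProduct.reindex_tprod (R := 𝕜) (s := M) e.symm f
  refine (congrArg (PiTensorProduct.reindex 𝕜 M e.symm).symm h).trans ?_
  rw [LinearEquiv.symm_apply_eq]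
  exact h2.symm

open Classical in
/-- `ins_j` for single slots: `x ⊗ t ↦ t` with `x` inserted in the `j`-th slot. -/
def insSlot {κ : Type} (M : κ → Type u) [∀ i, AddCommGroup (M i)] [∀ i, Module 𝕜 (M i)] (j : κ) :
    M j →ₗ[𝕜] (⨂[𝕜] i : ({j}ᶜ : Set κ), M i) →ₗ[𝕜] ⨂[𝕜] i, M i :=
  (TensorProduct.curry (PiTensorProduct.equivPiTensorComplSingletonTensor 𝕜 M j).symm.toLinearMap).flip

theorem insSlot_tprod {κ : Type} (M : κ → Type u) [∀ i, AddCommGroup (M i)]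
    [∀ i, Module 𝕜 (M i)] (j : κ) (f : ∀ i, M i) :
    insSlot 𝕜 M j (f j) (PiTensorProduct.tprod 𝕜 fun i : ({j}ᶜ : Set κ) => f i) =
      PiTensorProduct.tprod 𝕜 f := by
  classical
  have h := PiTensorProduct.equivPiTensorComplSingletonTensor_tprod 𝕜 M j f
  have h2 := (LinearEquiv.symm_apply_eq _).2 h.symm
  rw [← h2]
  simp only [insSlot, LinearMap.flip_apply, TensorProduct.curry_apply, LinearEquiv.coe_coe]
  congr!

/-- The slots `(r, p)`, `r ∈ κ`, `1 ≤ p ≤ d_r`, of a partition `m = ∑ r, d_r`, split into the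
`j`-th group and the remaining ones. -/
def groupEquiv {κ : Type} (d : κ → ℕ) (j : κ) :
    Fin (d j) ⊕ {s : Σ r, Fin (d r) // s.1 ≠ j} ≃ Σ r, Fin (d r) :=
  Equiv.ofBijective (Sum.elim (fun p => ⟨j, p⟩) Subtype.val) (by
    constructor
    · rintro (p | ⟨s, hs⟩) (q | ⟨t, ht⟩) h
      · simpa using h
      · subst h; exact absurd rfl ht
      · simp only [Sum.elim_inl, Sum.elim_inr] at h
        subst h; exact absurd rfl hs
      · simp only [Sum.elim_inr] at h
        subst h; rfl
    · rintro ⟨r, p⟩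
      by_cases h : r = j
      · subst h; exact ⟨.inl p, rfl⟩
      · exact ⟨.inr ⟨⟨r, p⟩, h⟩, rfl⟩)

/-- `ins_j` for grouped slots: the map
`U_j^{⊗ d_j} ⊗ ⨂_{r ≠ j} U_r^{⊗ d_r} → ⨂_r U_r^{⊗ d_r}`. -/
def insGroup {κ : Type} (d : κ → ℕ) (U : κ → Type u) [∀ r, AddCommGroup (U r)]
    [∀ r, Module 𝕜 (U r)] (j : κ) :
    (⨂[𝕜] _ : Fin (d j), U j) →ₗ[𝕜]
      (⨂[𝕜] s : {s : Σ r, Fin (d r) // s.1 ≠ j}, U s.1.1) →ₗ[𝕜] ⨂[𝕜] s : Σ r, Fin (d r), U s.1 :=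
  tensorMerge 𝕜 (groupEquiv d j) (fun s : Σ r, Fin (d r) => U s.1)

theorem insGroup_tprod {κ : Type} (d : κ → ℕ) (U : κ → Type u) [∀ r, AddCommGroup (U r)]
    [∀ r, Module 𝕜 (U r)] (j : κ) (f : ∀ s : Σ r, Fin (d r), U s.1) :
    insGroup 𝕜 d U j (PiTensorProduct.tprod 𝕜 fun p => f ⟨j, p⟩)
      (PiTensorProduct.tprod 𝕜 fun s => f s.1) = PiTensorProduct.tprod 𝕜 f :=
  tensorMerge_tprod 𝕜 (groupEquiv d j) (fun s : Σ r, Fin (d r) => U s.1) f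

end Tensors

/-! ### Factorization structures and their isomorphisms -/

section Main

variable {𝕜 : Type w} [RCLike 𝕜]

/-- `Σ_{j,ℓ} = V₁ ⊗ ⋯ ⊗ ℓ ⊗ ⋯ ⊗ V_m`, with the line `ℓ ⊆ V_j` in the `j`-th slot. -/
def slotSubspace {ι : Type} {V : ι → Type u} [∀ i, AddCommGroup (V i)] [∀ i, Module 𝕜 (V i)]
    (j : ι) (l : ℙ 𝕜 (V j)) : Submodule 𝕜 (⨂[𝕜] i, V i) :=
  Submodule.span 𝕜 {t | ∃ x : ∀ i, V i, x j ∈ l.submodule ∧ PiTensorProduct.tprod 𝕜 x = t}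

/-- `Σ⁰_{j,ℓ}`, the annihilator of `Σ_{j,ℓ}` in `V₁* ⊗ ⋯ ⊗ V_m*`. -/
def slotAnnihilator {ι : Type} [Finite ι] {V : ι → Type u} [∀ i, AddCommGroup (V i)]
    [∀ i, Module 𝕜 (V i)] (j : ι) (l : ℙ 𝕜 (V j)) :
    Submodule 𝕜 (⨂[𝕜] i, Dual 𝕜 (V i)) :=
  (slotSubspace j l).dualAnnihilator.comap PiTensorProduct.dualDistrib

/-- `φ : 𝔥 → V₁* ⊗ ⋯ ⊗ V_m*` is a factorization structure of dimension `m = Nat.card ι ≥ 1`: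
the `V_i` are 2-dimensional, `φ` is injective, `dim 𝔥 = m + 1`, and for every `j` the intersection
of the image with `Σ⁰_{j,ℓ}` is 1-dimensional for generic `ℓ ∈ ℙ(V_j)`. As `ℙ(V_j)` is a projective
line over an infinite field, its nonempty Zariski open sets are the complements of finite sets, so
`generic` means: for all but finitely many `ℓ`. -/
structure IsFactorizationStructure {ι : Type} [Finite ι] {V : ι → Type u}
    [∀ i, AddCommGroup (V i)] [∀ i, Module 𝕜 (V i)] {𝔥 : Type v} [AddCommGroup 𝔥] [Module 𝕜 𝔥]
    (φ : 𝔥 →ₗ[𝕜] ⨂[𝕜] i, Dual 𝕜 (V i)) : Prop where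
  nonempty : Nonempty ι
  finrank_slot : ∀ i, finrank 𝕜 (V i) = 2
  injective : Function.Injective φ
  finrank_eq : finrank 𝕜 𝔥 = Nat.card ι + 1
  generic : ∀ j : ι, ∀ᶠ l : ℙ 𝕜 (V j) in Filter.cofinite,
    finrank 𝕜 ↥(LinearMap.range φ ⊓ slotAnnihilator j l) = 1

/-! In the following, `U_i` stands for the dual space `V_i*` of the `i`-th slot (and `U_r`, `E_r`, `W`
in the grouped situation for `W_r*`): apart from the annihilators `Σ⁰_{j,ℓ}` all notions involve
only these dual spaces, and every finite-dimensional space is the dual of a space. -/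

/-- The isomorphism `(φ₁ ⊗ ⋯ ⊗ φ_m) ∘ σ : U₁ ⊗ ⋯ ⊗ U_m → U'₁ ⊗ ⋯ ⊗ U'_m` given by a bijection `σ`
of the slots (acting by braiding) and isomorphisms `f_j : U_{σ j} → U'_j`. -/
def slotIso {ι κ : Type} {U : ι → Type u} [∀ i, AddCommGroup (U i)] [∀ i, Module 𝕜 (U i)]
    {U' : κ → Type u} [∀ i, AddCommGroup (U' i)] [∀ i, Module 𝕜 (U' i)] (σ : κ ≃ ι)
    (f : ∀ j, U (σ j) ≃ₗ[𝕜] U' j) :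
    (⨂[𝕜] i, U i) ≃ₗ[𝕜] ⨂[𝕜] j, U' j :=
  (PiTensorProduct.reindex 𝕜 U σ.symm).trans (PiTensorProduct.congr f)

/-- `φ` and `ψ` are isomorphic in the sense of factorization structures. -/
def IsIsomorphic {ι κ : Type} {U : ι → Type u} [∀ i, AddCommGroup (U i)] [∀ i, Module 𝕜 (U i)]
    {U' : κ → Type u} [∀ i, AddCommGroup (U' i)] [∀ i, Module 𝕜 (U' i)]
    {𝔥 : Type*} [AddCommGroup 𝔥] [Module 𝕜 𝔥] {𝔤 : Type*} [AddCommGroup 𝔤] [Module 𝕜 𝔤]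
    (φ : 𝔥 →ₗ[𝕜] ⨂[𝕜] i, U i) (ψ : 𝔤 →ₗ[𝕜] ⨂[𝕜] i, U' i) : Prop :=
  ∃ (Φ : 𝔥 ≃ₗ[𝕜] 𝔤) (σ : κ ≃ ι) (f : ∀ j, U (σ j) ≃ₗ[𝕜] U' j),
    ∀ x, slotIso σ f (φ x) = ψ (Φ x)

/-! ### Segre-Veronese factorization structures -/

/-- The subspace `∑_j ins_j (S^{d_j} U_j ⊗ Γ_j)` of `⨂_r U_r^{⊗ d_r}`. -/
def svSubspace {κ : Type} (d : κ → ℕ) (U : κ → Type u) [∀ r, AddCommGroup (U r)]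
    [∀ r, Module 𝕜 (U r)]
    (Γ : ∀ j, Submodule 𝕜 (⨂[𝕜] s : {s : Σ r, Fin (d r) // s.1 ≠ j}, U s.1.1)) :
    Submodule 𝕜 (⨂[𝕜] s : Σ r, Fin (d r), U s.1) :=
  ⨆ j, Submodule.map₂ (insGroup 𝕜 d U j) (symTensors 𝕜 (Fin (d j)) (U j)) (Γ j)

/-- The canonical inclusion of `svSubspace d U Γ` into `⨂_r U_r^{⊗ d_r}`. -/
def svInclusion {κ : Type} (d : κ → ℕ) (U : κ → Type u) [∀ r, AddCommGroup (U r)]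
    [∀ r, Module 𝕜 (U r)]
    (Γ : ∀ j, Submodule 𝕜 (⨂[𝕜] s : {s : Σ r, Fin (d r) // s.1 ≠ j}, U s.1.1)) :
    svSubspace d U Γ →ₗ[𝕜] ⨂[𝕜] s : Σ r, Fin (d r), U s.1 :=
  (svSubspace d U Γ).subtype

/-- The data of a standard Segre-Veronese factorization structure: a partition `m = ∑ r, d_r` into
positive integers, 2-dimensional spaces `U_r`, and 1-dimensional spaces `Γ_j` (the defining tensors)
such that `∑_j ins_j (S^{d_j} U_j ⊗ Γ_j)` has dimension `m + 1`. The structure itself is the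
inclusion `svInclusion d U Γ`. -/
structure IsStandardSV {κ : Type} [Fintype κ] (d : κ → ℕ) (U : κ → Type u)
    [∀ r, AddCommGroup (U r)] [∀ r, Module 𝕜 (U r)]
    (Γ : ∀ j, Submodule 𝕜 (⨂[𝕜] s : {s : Σ r, Fin (d r) // s.1 ≠ j}, U s.1.1)) :
    Prop where
  pos : ∀ r, 1 ≤ d r
  finrank_slot : ∀ r, finrank 𝕜 (U r) = 2
  finrank_line : ∀ j, finrank 𝕜 (Γ j) = 1
  finrank_eq : finrank 𝕜 (svSubspace d U Γ) = (∑ r, d r) + 1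

/-- `φ` is a decomposable Segre-Veronese factorization structure: it is isomorphic to a standard one
all of whose defining tensors `Γ_j` are decomposable. -/
def IsDecomposableSegreVeronese {ι : Type} {U : ι → Type u} [∀ i, AddCommGroup (U i)]
    [∀ i, Module 𝕜 (U i)] {𝔥 : Type v} [AddCommGroup 𝔥] [Module 𝕜 𝔥]
    (φ : 𝔥 →ₗ[𝕜] ⨂[𝕜] i, U i) : Prop :=
  ∃ (κ : Type) (_ : Fintype κ) (d : κ → ℕ) (E : κ → Type u) (_ : ∀ r, AddCommGroup (E r))
    (_ : ∀ r, Module 𝕜 (E r))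
    (Γ : ∀ j, Submodule 𝕜 (⨂[𝕜] s : {s : Σ r, Fin (d r) // s.1 ≠ j}, E s.1.1)),
    IsStandardSV d E Γ ∧ (∀ j, IsDecomposableLine (Γ j)) ∧
      IsIsomorphic (U' := fun s : Σ r, Fin (d r) => E s.1) (𝔤 := svSubspace d E Γ) φ
        (svInclusion d E Γ)

/-! ### Decomposable Segre factorization structures and full-products -/

/-- The subspace `∑_j ins_j (U_j ⊗ Γ_j)` of `⨂_j U_j`. -/
def segreSubspace {κ : Type} {U : κ → Type u} [∀ i, AddCommGroup (U i)] [∀ i, Module 𝕜 (U i)]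
    (Γ : ∀ j, Submodule 𝕜 (⨂[𝕜] i : ({j}ᶜ : Set κ), U i)) :
    Submodule 𝕜 (⨂[𝕜] i, U i) :=
  ⨆ j, Submodule.map₂ (insSlot 𝕜 U j) ⊤ (Γ j)

/-- `H ⊆ ⨂_j U_j` is (the image of) a decomposable Segre factorization structure of dimension
`Nat.card κ`. -/
def IsDecomposableSegre {κ : Type} [Finite κ] {U : κ → Type u} [∀ i, AddCommGroup (U i)]
    [∀ i, Module 𝕜 (U i)] (H : Submodule 𝕜 (⨂[𝕜] i, U i)) : Prop :=
  (∀ i, finrank 𝕜 (U i) = 2) ∧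
    (∃ Γ : ∀ j, Submodule 𝕜 (⨂[𝕜] i : ({j}ᶜ : Set κ), U i),
      (∀ j, IsDecomposableLine (Γ j)) ∧ H = segreSubspace Γ) ∧
    finrank 𝕜 H = Nat.card κ + 1

/-- A decomposable Segre factorization structure `H` admits a full-product: either its dimension is
1, or for some slot `j` it equals `ins_j (q ⊗ Q + U_j ⊗ Γ)`, where `q ⊆ U_j` is a line, `Q` is a
decomposable Segre factorization structure on the slots other than `j` which admits a full-product,
and `Γ ⊆ Q` is a line. -/
inductive SegreAdmitsFullProduct : ∀ {κ : Type} [Finite κ] {U : κ → Type u}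
    [∀ i, AddCommGroup (U i)] [∀ i, Module 𝕜 (U i)],
    Submodule 𝕜 (⨂[𝕜] i, U i) → Prop
  | one {κ : Type} [Finite κ] {U : κ → Type u} [∀ i, AddCommGroup (U i)] [∀ i, Module 𝕜 (U i)]
      (H : Submodule 𝕜 (⨂[𝕜] i, U i)) (hH : IsDecomposableSegre H)
      (hκ : Nat.card κ = 1) : SegreAdmitsFullProduct H
  | inSlot {κ : Type} [Finite κ] {U : κ → Type u} [∀ i, AddCommGroup (U i)]
      [∀ i, Module 𝕜 (U i)]
      (H : Submodule 𝕜 (⨂[𝕜] i, U i)) (hH : IsDecomposableSegre H) (j : κ)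
      (q : Submodule 𝕜 (U j))
      (Q Γ : Submodule 𝕜 (⨂[𝕜] i : ({j}ᶜ : Set κ), U i))
      (hq : finrank 𝕜 q = 1) (hΓ : finrank 𝕜 Γ = 1) (hΓQ : Γ ≤ Q)
      (hQ : SegreAdmitsFullProduct Q)
      (hHQ : H = Submodule.map₂ (insSlot 𝕜 U j) q Q ⊔
        Submodule.map₂ (insSlot 𝕜 U j) ⊤ Γ) :
      SegreAdmitsFullProduct H

/-- The defining tensors `Γ_j = ⨂_{r ≠ j} ⟨a_j^r⟩^{⊗ d_r}` given by vectors `a_j^r ∈ U_r`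
(the vectors `a_j^j` play no role). -/
def powerLine {κ : Type} (d : κ → ℕ) {U : κ → Type u} [∀ r, AddCommGroup (U r)]
    [∀ r, Module 𝕜 (U r)] (a : κ → ∀ r, U r) (j : κ) :
    Submodule 𝕜 (⨂[𝕜] s : {s : Σ r, Fin (d r) // s.1 ≠ j}, U s.1.1) :=
  Submodule.span 𝕜 {PiTensorProduct.tprod 𝕜
    fun s : {s : Σ r, Fin (d r) // s.1 ≠ j} => a j s.1.1}

/-- `φ` is isomorphic to the standard Segre-Veronese factorization structure with partition `d` and
defining tensors `Γ_j = ⨂_{r ≠ j} ⟨a_j^r⟩^{⊗ d_r}`, where `a_j^r ∈ E_r` and `a_j^r ≠ 0` for `r ≠ j`. -/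
def IsPresentedBy {ι : Type} {U : ι → Type u} [∀ i, AddCommGroup (U i)]
    [∀ i, Module 𝕜 (U i)] {𝔥 : Type v} [AddCommGroup 𝔥] [Module 𝕜 𝔥]
    (φ : 𝔥 →ₗ[𝕜] ⨂[𝕜] i, U i) {κ : Type} [Fintype κ] (d : κ → ℕ) (E : κ → Type u)
    [∀ r, AddCommGroup (E r)] [∀ r, Module 𝕜 (E r)] (a : κ → ∀ r, E r) : Prop :=
  (∀ j r, r ≠ j → a j r ≠ 0) ∧ IsStandardSV d E (powerLine (𝕜 := 𝕜) d a) ∧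
    IsIsomorphic (U' := fun s : Σ r, Fin (d r) => E s.1) (𝔤 := svSubspace d E (powerLine (𝕜 := 𝕜) d a))
      φ (svInclusion d E (powerLine (𝕜 := 𝕜) d a))

/-- The Segre subspace `∑_j ins_j (U_j ⊗ ⨂_{r ≠ j} ⟨a_j^r⟩)` which corresponds to the
Segre-Veronese structure with the defining tensors `⨂_{r ≠ j} ⟨a_j^r⟩^{⊗ d_r}`. -/
def correspondingSegre {κ : Type} {U : κ → Type u} [∀ r, AddCommGroup (U r)]
    [∀ r, Module 𝕜 (U r)] (a : κ → ∀ r, U r) :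
    Submodule 𝕜 (⨂[𝕜] r, U r) :=
  segreSubspace fun j =>
    Submodule.span 𝕜 {PiTensorProduct.tprod 𝕜 fun i : ({j}ᶜ : Set κ) => a j i.1}

/-- A decomposable Segre-Veronese factorization structure `φ` admits a full-product if the
corresponding decomposable Segre factorization structure does. It is required that `φ` has a
presentation with `Γ_j = ⨂_{r ≠ j} ⟨a_j^r⟩^{⊗ d_r}`, and that for each such presentation the
corresponding Segre structure (which is part of `SegreAdmitsFullProduct`: it is a decomposable Segre
factorization structure) admits a full-product. -/
def AdmitsFullProduct {ι : Type} {U : ι → Type u} [∀ i, AddCommGroup (U i)]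
    [∀ i, Module 𝕜 (U i)] {𝔥 : Type v} [AddCommGroup 𝔥] [Module 𝕜 𝔥]
    (φ : 𝔥 →ₗ[𝕜] ⨂[𝕜] i, U i) : Prop :=
  (∃ (κ : Type) (_ : Fintype κ) (d : κ → ℕ) (E : κ → Type u) (_ : ∀ r, AddCommGroup (E r))
    (_ : ∀ r, Module 𝕜 (E r)) (a : κ → ∀ r, E r), IsPresentedBy φ d E a) ∧
  ∀ (κ : Type) (_ : Fintype κ) (d : κ → ℕ) (E : κ → Type u) (_ : ∀ r, AddCommGroup (E r))
    (_ : ∀ r, Module 𝕜 (E r)) (a : κ → ∀ r, E r), IsPresentedBy φ d E a →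
      SegreAdmitsFullProduct (correspondingSegre (𝕜 := 𝕜) a)

/-! ### Iterated products of Veronese factorization structures -/

/-- The smallest class of subspaces of tensor products `⨂_i U_i` which contains the Veronese
factorization structures `S^d W ⊆ W^{⊗ d}` (`d ≥ 1`, `dim W = 2`), is closed under the products
`H ⊗ T + S ⊗ K` with decomposable lines `S ⊆ H` and `T ⊆ K`, and under isomorphism. -/
inductive IsIteratedVeroneseProductSubspace : ∀ {ι : Type} {U : ι → Type u}
    [∀ i, AddCommGroup (U i)] [∀ i, Module 𝕜 (U i)],
    Submodule 𝕜 (⨂[𝕜] i, U i) → Prop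
  | veronese (d : ℕ) (hd : 1 ≤ d) (W : Type u) [AddCommGroup W] [Module 𝕜 W]
      (hW : finrank 𝕜 W = 2) :
      IsIteratedVeroneseProductSubspace (U := fun _ : Fin d => W)
        (symTensors 𝕜 (Fin d) W)
  | product {ι κ : Type} {U : ι ⊕ κ → Type u} [∀ i, AddCommGroup (U i)] [∀ i, Module 𝕜 (U i)]
      (H S : Submodule 𝕜 (⨂[𝕜] i : ι, U (.inl i)))
      (K T : Submodule 𝕜 (⨂[𝕜] i : κ, U (.inr i)))
      (hH : IsIteratedVeroneseProductSubspace H) (hK : IsIteratedVeroneseProductSubspace K)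
      (hSH : S ≤ H) (hS : IsDecomposableLine S) (hTK : T ≤ K) (hT : IsDecomposableLine T) :
      IsIteratedVeroneseProductSubspace
        (Submodule.map₂ (tensorMul 𝕜 U) H T ⊔
          Submodule.map₂ (tensorMul 𝕜 U) S K)
  | iso {ι κ : Type} {U : ι → Type u} [∀ i, AddCommGroup (U i)] [∀ i, Module 𝕜 (U i)]
      {U' : κ → Type u} [∀ i, AddCommGroup (U' i)] [∀ i, Module 𝕜 (U' i)] (σ : κ ≃ ι)
      (f : ∀ j, U (σ j) ≃ₗ[𝕜] U' j)
      (H : Submodule 𝕜 (⨂[𝕜] i, U i)) (hH : IsIteratedVeroneseProductSubspace H) :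
      IsIteratedVeroneseProductSubspace (H.map (slotIso σ f).toLinearMap)

/-- `φ` is, up to isomorphism, an iterated product of Veronese factorization structures. An
injective `φ` is identified with its image. -/
def IsIteratedVeroneseProduct {ι : Type} {U : ι → Type u} [∀ i, AddCommGroup (U i)]
    [∀ i, Module 𝕜 (U i)] {𝔥 : Type v} [AddCommGroup 𝔥] [Module 𝕜 𝔥]
    (φ : 𝔥 →ₗ[𝕜] ⨂[𝕜] i, U i) : Prop :=
  Function.Injective φ ∧ IsIteratedVeroneseProductSubspace (LinearMap.range φ)

end Main

end

end FactStr

/-!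
A tensor product of two-dimensional spaces is the ambient space of the Segre variety of a product of
projective lines, and a decomposable Segre-Veronese structure is the span of a family of rational
curves in it, one for each group of slots: since symmetric tensors are spanned by powers
(`symTensors_eq_powerSpan`), the summand `S^{d_j} U_j ⊗ Γ_j` is spanned by the tensors which have the
same vector `x` in all slots of the group `j` and fixed vectors `a j i` in the other slots `i`. After
identifying all slots with one plane `W`, this is `lineSpan`.

**Dimension.** Choose vectors `v i`, one for each slot, in general position, and an area form `ω` on
`W`. Putting `x = v p` on the curve of the group of `p` gives a tensor for each of the `m` slots `p`,
and one further point on some curve gives another one. The product functionals `∏ ω (v i)`, possibly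
with one factor replaced, are triangular with respect to these `m + 1` tensors
(`IsGenericFrame.coeff_eq_zero`). So the dimension of any such span is at least `m + 1`, and in the
case of equality these tensors form a basis, and a functional which kills them kills everything.
Evaluating suitable functionals gives the following.

* The vectors `a j i`, for `i` in one group, are parallel (`parallel_of_same_group`), so that `Γ_j` is
  a product of powers.
* Call `i` between `i'` and `j` if `a i' i` and `a j i` are not parallel. Then of two indices at most
  one lies between the other one and a third index (`parallel_or_parallel`); this is `IsTreelike`.
* If a line in the slot `p` is generic, it can be taken to be represented by `v p`, and then the basis
  tensor of `p` spans the intersection with the annihilator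
  (`finrank_lineSpanIn_inf_slotAnnihilator_of_frame`). So the map is a factorization structure.

**Trees.** A purely combinatorial induction shows that a tree-like family with at least two members
has a leaf `j`: all other curves have the same coordinate `q` in the direction `j`, and the `j`-th curve
meets another one (`IsTreelike.exists_leaf`). Removing the leaf writes the span as `q ⊗ Q + U_j ⊗ Γ`
with `Γ ⊆ Q` in the Segre case, and as the product of the span of the other curves with a Veronese
structure in general. Induction on the number of curves gives the full-product
(`segreAdmitsFullProduct_correspondingSegre`) and the iterated product
(`isIteratedVeroneseProductSubspace_lineSpan`).

**Converse.** The spans of the above form with the minimal dimension `m + 1` are closed under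
isomorphism and products: for `H ⊗ T + S ⊗ K` the upper bound for the dimension comes from the common
line `S ⊗ T` (`finrank_map₂_sup_add_one_le`), and the lower bound is the general one.
-/

namespace FactStr

/-! ### Parallel vectors and area forms on a plane -/

section Parallel

variable {𝕜 : Type w} [Field 𝕜] {M : Type*} [AddCommGroup M] [Module 𝕜 M]

variable (𝕜) in
/-- Two vectors are parallel if they differ by an invertible scalar; for nonzero vectors this says
that they span the same line. -/
def Parallel (x y : M) : Prop := ∃ c : 𝕜, c ≠ 0 ∧ y = c • x

theorem Parallel.refl (x : M) : Parallel 𝕜 x x := ⟨1, one_ne_zero, (one_smul _ _).symm⟩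

theorem Parallel.symm {x y : M} (h : Parallel 𝕜 x y) : Parallel 𝕜 y x := by
  obtain ⟨c, hc, rfl⟩ := h
  exact ⟨c⁻¹, inv_ne_zero hc, by rw [smul_smul, inv_mul_cancel₀ hc, one_smul]⟩

theorem Parallel.trans {x y z : M} (h : Parallel 𝕜 x y) (h' : Parallel 𝕜 y z) :
    Parallel 𝕜 x z := by
  obtain ⟨c, hc, rfl⟩ := h
  obtain ⟨d, hd, rfl⟩ := h'
  exact ⟨d * c, mul_ne_zero hd hc, by rw [smul_smul]⟩

theorem Parallel.map {N : Type*} [AddCommGroup N] [Module 𝕜 N] (f : M →ₗ[𝕜] N) {x y : M}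
    (h : Parallel 𝕜 x y) : Parallel 𝕜 (f x) (f y) := by
  obtain ⟨c, hc, rfl⟩ := h
  exact ⟨c, hc, map_smul f c x⟩

theorem Parallel.tprod {ι : Type*} [Finite ι] {M : ι → Type*} [∀ i, AddCommGroup (M i)]
    [∀ i, Module 𝕜 (M i)] {f f' : ∀ i, M i} (h : ∀ i, Parallel 𝕜 (f i) (f' i)) :
    Parallel 𝕜 (PiTensorProduct.tprod 𝕜 f) (PiTensorProduct.tprod 𝕜 f') := by
  have := Fintype.ofFinite ι
  choose c hc hf using h
  obtain rfl : f' = fun i => c i • f i := funext hf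
  exact ⟨∏ i, c i, Finset.prod_ne_zero_iff.2 fun i _ => hc i, MultilinearMap.map_smul_univ _ _ _⟩

/-- An area form on a plane: a bilinear form `ω` such that `ω x y = 0` holds for `x = y`, and,
for `x ≠ 0`, only for multiples `y` of `x`. -/
structure IsAreaForm (ω : M ≃ₗ[𝕜] Dual 𝕜 M) : Prop where
  self : ∀ x, ω x x = 0
  exists_smul : ∀ x y, x ≠ 0 → ω x y = 0 → ∃ c : 𝕜, y = c • x

theorem exists_isAreaForm (h : finrank 𝕜 M = 2) : ∃ ω : M ≃ₗ[𝕜] Dual 𝕜 M, IsAreaForm ω := by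
  have : Module.Finite 𝕜 M := Module.finite_of_finrank_pos (by omega)
  let b := finBasisOfFinrankEq 𝕜 M h
  let ω : M →ₗ[𝕜] Dual 𝕜 M :=
    (b.coord 0).smulRight (b.coord 1) - (b.coord 1).smulRight (b.coord 0)
  have hω : ∀ x y, ω x y = b.repr x 0 * b.repr y 1 - b.repr x 1 * b.repr y 0 := fun x y => by
    simp [ω]
  have hpar : ∀ x y, x ≠ 0 → ω x y = 0 → ∃ c : 𝕜, y = c • x := by
    intro x y hx h0
    rw [hω] at h0
    have key : ∀ c : 𝕜, b.repr y 0 = c * b.repr x 0 → b.repr y 1 = c * b.repr x 1 → y = c • x := by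
      intro c h1 h2
      refine b.ext_elem fun i => ?_
      fin_cases i <;> simp [h1, h2]
    by_cases hx0 : b.repr x 0 = 0
    · have hx1 : b.repr x 1 ≠ 0 := fun hx1 => hx (b.ext_elem fun i => by
        fin_cases i <;> simp [hx0, hx1])
      refine ⟨b.repr y 1 / b.repr x 1, key _ ?_ (by field_simp)⟩
      field_simp
      linear_combination -h0
    · refine ⟨b.repr y 0 / b.repr x 0, key _ (by field_simp) ?_⟩
      field_simp
      linear_combination h0
  have hinj : Function.Injective ω := by
    rw [← LinearMap.ker_eq_bot, LinearMap.ker_eq_bot']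
    intro x hx
    by_contra hx0
    have hall : ∀ y, ∃ c : 𝕜, c • x = y := fun y =>
      (hpar x y hx0 (by rw [hx]; rfl)).imp fun _ h => h.symm
    have := finrank_eq_one x hx0 hall
    omega
  refine ⟨ω.linearEquivOfInjective hinj (Subspace.dual_finrank_eq (K := 𝕜) (V := M)).symm,
    fun x => ?_, fun x y hx h0 => hpar x y hx ?_⟩
  · rw [LinearMap.linearEquivOfInjective_apply, hω, mul_comm, sub_self]
  · rwa [LinearMap.linearEquivOfInjective_apply] at h0

namespace IsAreaForm

variable {ω : M ≃ₗ[𝕜] Dual 𝕜 M}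

theorem neg_swap (hω : IsAreaForm ω) (x y : M) : ω x y = -ω y x := by
  have h := hω.self (x + y)
  simp only [map_add, LinearMap.add_apply, hω.self, zero_add, add_zero] at h
  exact eq_neg_of_add_eq_zero_right h

theorem ne_zero_comm (hω : IsAreaForm ω) {x y : M} (h : ω x y ≠ 0) : ω y x ≠ 0 := by
  rw [hω.neg_swap]
  exact neg_ne_zero.2 h

theorem parallel (hω : IsAreaForm ω) {x y : M} (hx : x ≠ 0) (hy : y ≠ 0) (h : ω x y = 0) : Parallel 𝕜 x y := by
  obtain ⟨c, rfl⟩ := hω.exists_smul x y hx h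
  exact ⟨c, fun hc => hy (by rw [hc, zero_smul]), rfl⟩

end IsAreaForm

theorem exists_forall_apply_ne_zero [Infinite 𝕜] (ω : M ≃ₗ[𝕜] Dual 𝕜 M) {α : Type*} [Finite α]
    (b : α → M) (hb : ∀ i, b i ≠ 0) : ∃ x, ∀ i, ω x (b i) ≠ 0 := by
  obtain ⟨f, hf⟩ := Module.exists_dual_forall_apply_ne_zero (K := 𝕜) b hb
  exact ⟨ω.symm f, by simpa using hf⟩

end Parallel

/-! ### Spans of lines and their generic bases -/

section LineSpan

variable {W : Type*} {ι κ : Type}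

open Classical in
/-- The family of vectors which is `x` in all slots of the `j`-th group, and `a j i` in the slots
`i` outside this group. Here `g i` is the group of the slot `i`. -/
noncomputable def lineVec (g : ι → κ) (a : κ → ι → W) (j : κ) (x : W) : ι → W :=
  fun i => if g i = j then x else a j i

theorem lineVec_of_eq {g : ι → κ} {a : κ → ι → W} {j : κ} {x : W} {i : ι} (h : g i = j) :
    lineVec g a j x i = x := if_pos h

theorem lineVec_of_ne {g : ι → κ} {a : κ → ι → W} {j : κ} {x : W} {i : ι} (h : g i ≠ j) :
    lineVec g a j x i = a j i := if_neg h

variable {𝕜 : Type w} [Field 𝕜] [AddCommGroup W] [Module 𝕜 W]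

variable (𝕜) in
/-- The sum over the groups `j` of the spaces `S^{d_j} W ⊗ ⟨⨂_{g i ≠ j} a j i⟩`, where all slots
carry the same plane `W`. It is defined as a span, using that symmetric tensors are spanned by
powers. -/
def lineSpan (g : ι → κ) (a : κ → ι → W) : Submodule 𝕜 (⨂[𝕜] _ : ι, W) :=
  Submodule.span 𝕜 (Set.range fun p : κ × W => PiTensorProduct.tprod 𝕜 (lineVec g a p.1 p.2))

theorem tprod_lineVec_mem (g : ι → κ) (a : κ → ι → W) (j : κ) (x : W) :
    PiTensorProduct.tprod 𝕜 (lineVec g a j x) ∈ lineSpan 𝕜 g a :=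
  Submodule.subset_span ⟨(j, x), rfl⟩

/-- The product of the functionals `ω (m i)`, as a functional on tensors. -/
noncomputable def prodForm [Finite ι] (ω : W ≃ₗ[𝕜] Dual 𝕜 W) (m : ι → W) :
    (⨂[𝕜] _ : ι, W) →ₗ[𝕜] 𝕜 :=
  PiTensorProduct.dualDistrib (PiTensorProduct.tprod 𝕜 fun i => ω (m i))

theorem prodForm_tprod [Fintype ι] (ω : W ≃ₗ[𝕜] Dual 𝕜 W) (m f : ι → W) :
    prodForm ω m (PiTensorProduct.tprod 𝕜 f) = ∏ i, ω (m i) (f i) :=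
  PiTensorProduct.dualDistrib_apply _ _

theorem prodForm_eq_zero [Finite ι] (ω : W ≃ₗ[𝕜] Dual 𝕜 W) {m f : ι → W} (i : ι)
    (h : ω (m i) (f i) = 0) : prodForm ω m (PiTensorProduct.tprod 𝕜 f) = 0 := by
  have := Fintype.ofFinite ι
  rw [prodForm_tprod]
  exact Finset.prod_eq_zero (Finset.mem_univ i) h

theorem prodForm_ne_zero [Finite ι] (ω : W ≃ₗ[𝕜] Dual 𝕜 W) {m f : ι → W}
    (h : ∀ i, ω (m i) (f i) ≠ 0) : prodForm ω m (PiTensorProduct.tprod 𝕜 f) ≠ 0 := by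
  have := Fintype.ofFinite ι
  rw [prodForm_tprod]
  exact Finset.prod_ne_zero_iff.2 fun i _ => h i

/-- Auxiliary vectors `v i` (one for each slot) and `x₀` in general position with respect to each
other and to the vectors `a j i`. -/
structure IsGenericFrame (ω : W ≃ₗ[𝕜] Dual 𝕜 W) (g : ι → κ) (a : κ → ι → W) (v : ι → W)
    (x₀ : W) : Prop where
  pairwise : ∀ i i', i ≠ i' → ω (v i) (v i') ≠ 0
  line : ∀ i j, g i ≠ j → ω (v i) (a j i) ≠ 0
  base : ∀ i, ω (v i) x₀ ≠ 0

/-- Generic frames exist; moreover one of the vectors `v i` can be prescribed. -/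
theorem exists_isGenericFrame [Infinite 𝕜] [Finite ι] [Finite κ] {ω : W ≃ₗ[𝕜] Dual 𝕜 W}
    (hω : IsAreaForm ω) (g : ι → κ) (a : κ → ι → W) (ha : ∀ j i, g i ≠ j → a j i ≠ 0)
    (p : ι) (v₀ : W) (hv₀ : v₀ ≠ 0) (hp : ∀ j, g p ≠ j → ω v₀ (a j p) ≠ 0) :
    ∃ v x₀, v p = v₀ ∧ IsGenericFrame ω g a v x₀ := by
  classical
  have := Fintype.ofFinite ι
  have main : ∀ s : Finset ι, ∃ v : ι → W, v p = v₀ ∧ (∀ i ∈ insert p s, v i ≠ 0) ∧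
      (∀ i ∈ insert p s, ∀ i' ∈ insert p s, i ≠ i' → ω (v i) (v i') ≠ 0) ∧
      ∀ i ∈ insert p s, ∀ j, g i ≠ j → ω (v i) (a j i) ≠ 0 := by
    intro s
    induction s using Finset.induction_on with
    | empty =>
      refine ⟨fun _ => v₀, rfl, fun _ _ => hv₀, ?_, ?_⟩
      · intro i hi i' hi' hne
        simp only [insert_empty_eq, Finset.mem_singleton] at hi hi'
        exact absurd (hi.trans hi'.symm) hne
      · intro i hi
        simp only [insert_empty_eq, Finset.mem_singleton] at hi
        subst hi
        exact hp
    | insert q s hq ih =>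
      obtain ⟨v, hvp, hv0, hvv, hva⟩ := ih
      by_cases hqp : q = p
      · subst hqp
        exact ⟨v, hvp, by simpa using hv0, by simpa using hvv, by simpa using hva⟩
      have hqs : q ∉ insert p s := by simp [hqp, hq]
      obtain ⟨x, hx⟩ := exists_forall_apply_ne_zero ω
        (Sum.elim (fun i : {i // i ∈ insert p s} => v i) (fun j : {j // g q ≠ j} => a j q))
        (by rintro (i | j); exacts [hv0 i i.2, ha j q j.2])
      have hx1 : ∀ i ∈ insert p s, ω x (v i) ≠ 0 := fun i hi => hx (.inl ⟨i, hi⟩)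
      have hx2 : ∀ j, g q ≠ j → ω x (a j q) ≠ 0 := fun j hj => hx (.inr ⟨j, hj⟩)
      have hx0 : x ≠ 0 := by
        rintro rfl
        exact hx1 p (Finset.mem_insert_self _ _) (by simp)
      have hold : ∀ i ∈ insert p s, Function.update v q x i = v i := fun i hi =>
        Function.update_of_ne (fun h : i = q => hqs (h ▸ hi)) _ _
      have hnew : Function.update v q x q = x := Function.update_self _ _ _
      have hmem : ∀ i, i ∈ insert p (insert q s) → i = q ∨ i ∈ insert p s := by
        intro i hi
        simp only [Finset.mem_insert] at hi ⊢
        tauto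
      refine ⟨Function.update v q x, ?_, ?_, ?_, ?_⟩
      · rw [hold p (Finset.mem_insert_self _ _), hvp]
      · intro i hi
        obtain h | h := hmem i hi
        · rwa [h, hnew]
        · rw [hold i h]; exact hv0 i h
      · intro i hi i' hi' hne
        obtain h | h := hmem i hi <;> obtain h' | h' := hmem i' hi'
        · exact absurd (h.trans h'.symm) hne
        · rw [h, hnew, hold i' h']; exact hx1 i' h'
        · rw [h', hnew, hold i h]; exact hω.ne_zero_comm (hx1 i h)
        · rw [hold i h, hold i' h']; exact hvv i h i' h' hne
      · intro i hi j hj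
        obtain h | h := hmem i hi
        · rw [h, hnew]; exact hx2 j (h ▸ hj)
        · rw [hold i h]; exact hva i h j hj
  obtain ⟨v, hvp, hv0, hvv, hva⟩ := main Finset.univ
  simp only [Finset.mem_univ, Finset.mem_insert, or_true, forall_true_left] at hv0 hvv hva
  obtain ⟨x₀, hx₀⟩ := exists_forall_apply_ne_zero ω v hv0
  exact ⟨v, x₀, hvp, hvv, hva, fun i => hω.ne_zero_comm (hx₀ i)⟩

/-- The tensors `h_p`, `p` a slot, and `h_none`: `h_p` lies on the line of the group of `p` and is
killed by `ω (v p)` in the slot `p`, while `h_none` is a generic tensor on the line `j₀`. -/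
noncomputable def frameTensor (𝕜 : Type w) [Field 𝕜] {W : Type*} [AddCommGroup W] [Module 𝕜 W]
    (g : ι → κ) (a : κ → ι → W) (v : ι → W) (x₀ : W) (j₀ : κ) :
    Option ι → ⨂[𝕜] _ : ι, W
  | none => PiTensorProduct.tprod 𝕜 (lineVec g a j₀ x₀)
  | some p => PiTensorProduct.tprod 𝕜 (lineVec g a (g p) (v p))

theorem frameTensor_mem (g : ι → κ) (a : κ → ι → W) (v : ι → W) (x₀ : W) (j₀ : κ)
    (o : Option ι) : frameTensor 𝕜 g a v x₀ j₀ o ∈ lineSpan 𝕜 g a := by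
  cases o <;> exact tprod_lineVec_mem g a _ _

namespace IsGenericFrame

variable {ω : W ≃ₗ[𝕜] Dual 𝕜 W} {g : ι → κ} {a : κ → ι → W} {v : ι → W} {x₀ : W}

theorem lineVec_base_ne_zero (hv : IsGenericFrame ω g a v x₀) (j : κ) (i : ι) :
    ω (v i) (lineVec g a j x₀ i) ≠ 0 := by
  by_cases h : g i = j
  · rw [lineVec_of_eq h]; exact hv.base i
  · rw [lineVec_of_ne h]; exact hv.line i j h

theorem lineVec_ne_zero (hv : IsGenericFrame ω g a v x₀) (p i : ι) (h : i ≠ p) :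
    ω (v i) (lineVec g a (g p) (v p) i) ≠ 0 := by
  by_cases h' : g i = g p
  · rw [lineVec_of_eq h']; exact hv.pairwise i p h
  · rw [lineVec_of_ne h']; exact hv.line i _ h'

/-- The functionals `∏ ω (v i)` and `ω x₀ ⊗ ∏_{i ≠ q} ω (v i)` form a triangular system with the
tensors `frameTensor`, so they detect all coefficients of a linear combination. -/
theorem coeff_eq_zero [Fintype ι] (hω : IsAreaForm ω) (hv : IsGenericFrame ω g a v x₀) (j₀ : κ)
    (c : Option ι → 𝕜) {t : ⨂[𝕜] _ : ι, W}
    (ht : ∑ o, c o • frameTensor 𝕜 g a v x₀ j₀ o = t) (hnone : prodForm ω v t = 0) :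
    c none = 0 ∧
      ∀ m : ι → W, ∀ q, (∀ i, i ≠ q → m i = v i) → m q = x₀ → prodForm ω m t = 0 →
        c (some q) = 0 := by
  have h0 : c none = 0 := by
    rw [← ht, Fintype.sum_option, map_add, map_smul, map_sum, Finset.sum_eq_zero, add_zero,
      smul_eq_mul, mul_eq_zero] at hnone
    · exact hnone.resolve_right (prodForm_ne_zero ω (hv.lineVec_base_ne_zero j₀))
    · intro p _
      rw [map_smul, frameTensor, prodForm_eq_zero ω p, smul_zero]
      rw [lineVec_of_eq rfl]
      exact hω.self _
  refine ⟨h0, fun m q hm hmq hmt => ?_⟩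
  rw [← ht, Fintype.sum_option, h0, zero_smul, zero_add, map_sum, Finset.sum_eq_single q,
    map_smul, smul_eq_mul, mul_eq_zero] at hmt
  · refine hmt.resolve_right (prodForm_ne_zero ω fun i => ?_)
    by_cases h : i = q
    · subst h
      rw [hmq, lineVec_of_eq rfl]
      exact hω.ne_zero_comm (hv.base i)
    · rw [hm i h]
      exact hv.lineVec_ne_zero q i h
  · intro p _ hp
    rw [map_smul, frameTensor, prodForm_eq_zero ω p, smul_zero]
    rw [lineVec_of_eq rfl, hm p hp]
    exact hω.self _
  · intro h
    exact absurd (Finset.mem_univ q) h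

theorem linearIndependent [Fintype ι] (hω : IsAreaForm ω) (hv : IsGenericFrame ω g a v x₀)
    (j₀ : κ) : LinearIndependent 𝕜 (frameTensor 𝕜 g a v x₀ j₀) := by
  classical
  rw [Fintype.linearIndependent_iff]
  intro c hc o
  have h := hv.coeff_eq_zero hω j₀ c hc (map_zero _)
  cases o with
  | none => exact h.1
  | some q =>
    exact h.2 (Function.update v q x₀) q (fun i hi => Function.update_of_ne hi _ _)
      (Function.update_self _ _ _) (map_zero _)

theorem span_eq [Fintype ι] [Module.Finite 𝕜 W] (hω : IsAreaForm ω)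
    (hv : IsGenericFrame ω g a v x₀) (j₀ : κ)
    (hdim : finrank 𝕜 (lineSpan 𝕜 g a) = Nat.card ι + 1) :
    Submodule.span 𝕜 (Set.range (frameTensor 𝕜 g a v x₀ j₀)) = lineSpan 𝕜 g a := by
  refine Submodule.eq_of_le_of_finrank_eq ?_ ?_
  · rw [Submodule.span_le]
    rintro _ ⟨o, rfl⟩
    exact frameTensor_mem g a v x₀ j₀ o
  · rw [finrank_span_eq_card (hv.linearIndependent hω j₀), hdim, Fintype.card_option,
      Nat.card_eq_fintype_card]

/-- A functional which vanishes on the tensors of a generic basis vanishes on the whole span. -/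
theorem apply_eq_zero [Fintype ι] [Module.Finite 𝕜 W] (hω : IsAreaForm ω)
    (hv : IsGenericFrame ω g a v x₀) (j₀ : κ)
    (hdim : finrank 𝕜 (lineSpan 𝕜 g a) = Nat.card ι + 1) (L : (⨂[𝕜] _ : ι, W) →ₗ[𝕜] 𝕜)
    (h₀ : L (PiTensorProduct.tprod 𝕜 (lineVec g a j₀ x₀)) = 0)
    (h : ∀ p, L (PiTensorProduct.tprod 𝕜 (lineVec g a (g p) (v p))) = 0) (j : κ) (x : W) :
    L (PiTensorProduct.tprod 𝕜 (lineVec g a j x)) = 0 := by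
  have hle : Submodule.span 𝕜 (Set.range (frameTensor 𝕜 g a v x₀ j₀)) ≤ LinearMap.ker L := by
    rw [Submodule.span_le]
    rintro _ ⟨_ | p, rfl⟩
    exacts [h₀, h p]
  rw [hv.span_eq hω j₀ hdim] at hle
  exact hle (tprod_lineVec_mem g a j x)

end IsGenericFrame

variable [Infinite 𝕜] [Finite ι] [Finite κ]

theorem exists_frame (hW : finrank 𝕜 W = 2) (g : ι → κ) (a : κ → ι → W)
    (ha : ∀ j i, g i ≠ j → a j i ≠ 0) :
    ∃ (ω : W ≃ₗ[𝕜] Dual 𝕜 W) (v : ι → W) (x₀ : W), IsAreaForm ω ∧ IsGenericFrame ω g a v x₀ := by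
  obtain ⟨ω, hω⟩ := exists_isAreaForm hW
  rcases isEmpty_or_nonempty ι with hι | ⟨⟨p⟩⟩
  · exact ⟨ω, fun i => (hι.false i).elim, 0, hω, fun i => (hι.false i).elim,
      fun i => (hι.false i).elim, fun i => (hι.false i).elim⟩
  · have : Nontrivial W := nontrivial_of_finrank_pos (R := 𝕜) (by omega)
    obtain ⟨w, hw⟩ := exists_ne (0 : W)
    obtain ⟨v₀, hv₀⟩ := exists_forall_apply_ne_zero ω
      (fun o : Option {j // g p ≠ j} => o.elim w fun j => a j p)
      (by rintro (_ | j); exacts [hw, ha j p j.2])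
    have hne : v₀ ≠ 0 := by
      rintro rfl
      exact hv₀ none (by simp)
    obtain ⟨v, x₀, -, hv⟩ := exists_isGenericFrame hω g a ha p v₀ hne
      fun j hj => hv₀ (some ⟨j, hj⟩)
    exact ⟨ω, v, x₀, hω, hv⟩

/-- The minimal possible dimension: whatever the lines are, the span has dimension at least
`m + 1`. -/
theorem card_add_one_le_finrank_lineSpan [Nonempty κ] (hW : finrank 𝕜 W = 2) (g : ι → κ)
    (a : κ → ι → W) (ha : ∀ j i, g i ≠ j → a j i ≠ 0) :
    Nat.card ι + 1 ≤ finrank 𝕜 (lineSpan 𝕜 g a) := by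
  have := Fintype.ofFinite ι
  have : Module.Finite 𝕜 W := Module.finite_of_finrank_pos (by omega)
  obtain ⟨ω, v, x₀, hω, hv⟩ := exists_frame hW g a ha
  have j₀ : κ := Classical.arbitrary κ
  rw [Nat.card_eq_fintype_card, ← Fintype.card_option,
    ← finrank_span_eq_card (hv.linearIndependent hω j₀)]
  refine Submodule.finrank_mono ?_
  rw [Submodule.span_le]
  rintro _ ⟨o, rfl⟩
  exact frameTensor_mem g a v x₀ j₀ o

/-- In minimal dimension the vectors `a j i` belonging to the slots of one group are all parallel:
otherwise the functional `α ⊗ β - β ⊗ α` on two such slots, with `α = ω (a j s)` and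
`β = ω (a j s')`, kills a basis but not the `j`-th line. -/
theorem parallel_of_same_group (hW : finrank 𝕜 W = 2) {g : ι → κ} {a : κ → ι → W}
    (ha : ∀ j i, g i ≠ j → a j i ≠ 0)
    (hdim : finrank 𝕜 (lineSpan 𝕜 g a) = Nat.card ι + 1) {s s' : ι} (hs : g s = g s') {j : κ}
    (hj : g s ≠ j) : Parallel 𝕜 (a j s) (a j s') := by
  classical
  have := Fintype.ofFinite ι
  have : Module.Finite 𝕜 W := Module.finite_of_finrank_pos (by omega)
  obtain rfl | hne := eq_or_ne s s'
  · exact Parallel.refl _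
  obtain ⟨ω, v, x₀, hω, hv⟩ := exists_frame hW g a ha
  by_contra hpar
  have h0 : ω (a j s) (a j s') ≠ 0 := fun h =>
    hpar (hω.parallel (ha j s hj) (ha j s' (hs ▸ hj)) h)
  let m : W → W → ι → W := fun y y' => Function.update (Function.update v s y) s' y'
  have hm' : ∀ y y', m y y' s' = y' := fun y y' => Function.update_self _ _ _
  have hm : ∀ y y', m y y' s = y := fun y y' =>
    (Function.update_of_ne hne _ _).trans (Function.update_self _ _ _)
  have hmo : ∀ y y' i, i ≠ s → i ≠ s' → m y y' i = v i := fun y y' i h h' =>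
    (Function.update_of_ne h' _ _).trans (Function.update_of_ne h _ _)
  -- On the line of the group of `s` both terms of the functional agree.
  have hline : ∀ x, prodForm ω (m (a j s) (a j s')) (PiTensorProduct.tprod 𝕜 (lineVec g a (g s) x))
      = prodForm ω (m (a j s') (a j s)) (PiTensorProduct.tprod 𝕜 (lineVec g a (g s) x)) := by
    intro x
    rw [prodForm_tprod, prodForm_tprod, ← Finset.prod_erase_mul _ _ (Finset.mem_univ s),
      ← Finset.prod_erase_mul (Finset.univ.erase s) _
        (Finset.mem_erase.2 ⟨hne.symm, Finset.mem_univ s'⟩),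
      ← Finset.prod_erase_mul (a := s) Finset.univ (fun i => ω (m (a j s') (a j s) i) _)
        (Finset.mem_univ s),
      ← Finset.prod_erase_mul (Finset.univ.erase s) (fun i => ω (m (a j s') (a j s) i) _)
        (Finset.mem_erase.2 ⟨hne.symm, Finset.mem_univ s'⟩)]
    rw [hm, hm', hm, hm', lineVec_of_eq rfl, lineVec_of_eq hs.symm, mul_assoc, mul_assoc,
      mul_comm (ω (a j s') x)]
    refine congrArg₂ _ (Finset.prod_congr rfl fun i hi => ?_) rfl
    simp only [Finset.mem_erase] at hi
    rw [hmo _ _ i hi.2.1 hi.1, hmo _ _ i hi.2.1 hi.1]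
  have key := hv.apply_eq_zero hω (g s) hdim
    (prodForm ω (m (a j s) (a j s')) - prodForm ω (m (a j s') (a j s)))
    (by rw [LinearMap.sub_apply, hline, sub_self])
    (fun p => by
      by_cases hp : g p = g s
      · rw [hp, LinearMap.sub_apply, hline, sub_self]
      · have h1 : ∀ y y', prodForm ω (m y y')
            (PiTensorProduct.tprod 𝕜 (lineVec g a (g p) (v p))) = 0 := fun y y' =>
          prodForm_eq_zero ω p (by
            rw [lineVec_of_eq rfl, hmo y y' p (fun h => hp (h ▸ rfl)) (fun h => hp (h ▸ hs.symm))]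
            exact hω.self _)
        rw [LinearMap.sub_apply, h1, h1, sub_self]) j x₀
  rw [LinearMap.sub_apply, prodForm_eq_zero ω s, zero_sub, neg_eq_zero] at key
  · refine prodForm_ne_zero ω (fun i => ?_) key
    by_cases h : i = s
    · subst h
      rw [hm, lineVec_of_ne hj]
      exact hω.ne_zero_comm h0
    by_cases h' : i = s'
    · subst h'
      rw [hm', lineVec_of_ne (hs ▸ hj)]
      exact h0
    rw [hmo _ _ i h h']
    exact hv.lineVec_base_ne_zero j i
  · rw [hm, lineVec_of_ne hj]
    exact hω.self _

/-- In minimal dimension, for slots `s`, `s'` in different groups and a third group `j`: the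
functional `ω (a (g s') s) ⊗ ω (a (g s) s')` on these two slots kills a basis, hence the `j`-th
line. -/
theorem parallel_or_parallel (hW : finrank 𝕜 W = 2) {g : ι → κ} {a : κ → ι → W}
    (ha : ∀ j i, g i ≠ j → a j i ≠ 0)
    (hdim : finrank 𝕜 (lineSpan 𝕜 g a) = Nat.card ι + 1) {s s' : ι} (hs : g s ≠ g s') {j : κ}
    (hj : g s ≠ j) (hj' : g s' ≠ j) :
    Parallel 𝕜 (a (g s') s) (a j s) ∨ Parallel 𝕜 (a (g s) s') (a j s') := by
  classical
  have := Fintype.ofFinite ι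
  have : Module.Finite 𝕜 W := Module.finite_of_finrank_pos (by omega)
  have hne : s ≠ s' := fun h => hs (h ▸ rfl)
  obtain ⟨ω, v, x₀, hω, hv⟩ := exists_frame hW g a ha
  by_contra! hpar
  have h1 : ω (a (g s') s) (a j s) ≠ 0 := fun h =>
    hpar.1 (hω.parallel (ha _ s hs) (ha j s hj) h)
  have h2 : ω (a (g s) s') (a j s') ≠ 0 := fun h =>
    hpar.2 (hω.parallel (ha _ s' hs.symm) (ha j s' hj') h)
  let m : ι → W := Function.update (Function.update v s (a (g s') s)) s' (a (g s) s')
  have hm' : m s' = a (g s) s' := Function.update_self _ _ _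
  have hm : m s = a (g s') s :=
    (Function.update_of_ne hne _ _).trans (Function.update_self _ _ _)
  have hmo : ∀ i, i ≠ s → i ≠ s' → m i = v i := fun i h h' =>
    (Function.update_of_ne h' _ _).trans (Function.update_of_ne h _ _)
  have hz : ∀ x, prodForm ω m (PiTensorProduct.tprod 𝕜 (lineVec g a (g s) x)) = 0 := fun x =>
    prodForm_eq_zero ω s' (by rw [hm', lineVec_of_ne hs.symm]; exact hω.self _)
  have hz' : ∀ x, prodForm ω m (PiTensorProduct.tprod 𝕜 (lineVec g a (g s') x)) = 0 := fun x =>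
    prodForm_eq_zero ω s (by rw [hm, lineVec_of_ne hs]; exact hω.self _)
  refine prodForm_ne_zero ω (fun i => ?_) (hv.apply_eq_zero hω (g s) hdim (prodForm ω m) (hz _)
    (fun p => ?_) j x₀)
  · by_cases h : i = s
    · subst h
      rwa [hm, lineVec_of_ne hj]
    by_cases h' : i = s'
    · subst h'
      rwa [hm', lineVec_of_ne hj']
    rw [hmo i h h']
    exact hv.lineVec_base_ne_zero j i
  · by_cases h : p = s
    · subst h; exact hz _
    by_cases h' : p = s'
    · subst h'; exact hz' _
    exact prodForm_eq_zero ω p (by rw [hmo p h h', lineVec_of_eq rfl]; exact hω.self _)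

end LineSpan

/-! ### Tree-like families of lines -/

section Treelike

variable {𝕜 : Type w} [Field 𝕜] {κ : Type} {U : κ → Type u} [∀ r, AddCommGroup (U r)]
  [∀ r, Module 𝕜 (U r)]

variable (𝕜) in
/-- The local form of connectedness for lines in a product of projective lines, the `j`-th one
being the line in direction `j` through the point with coordinates `a j r`, `r ≠ j`. Saying that `i`
lies between `i'` and `j` if `a i' i` and `a j i` are not parallel, the condition is that of two
indices at most one lies between the other one and a third index `j`, as in a tree. -/
def IsTreelike (a : κ → ∀ r, U r) : Prop :=
  ∀ i i' j, i ≠ i' → i ≠ j → i' ≠ j →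
    Parallel 𝕜 (a i' i) (a j i) ∨ Parallel 𝕜 (a i i') (a j i')

namespace IsTreelike

variable {a : κ → ∀ r, U r}

theorem restrict (ha : IsTreelike 𝕜 a) (p : κ → Prop) :
    IsTreelike 𝕜 (fun (j r : {r // p r}) => a j r) := fun i i' j h1 h2 h3 =>
  ha i i' j (Subtype.coe_ne_coe.2 h1) (Subtype.coe_ne_coe.2 h2) (Subtype.coe_ne_coe.2 h3)

/-- Every finite set of at least two indices contains at least two leaves. To find a leaf other
than a given index `j`, take two leaves after removing `j`: if neither were a leaf of the whole set,
each of them would lie between `j` and the other one. -/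
theorem exists_two_leaves (ha : IsTreelike 𝕜 a) (s : Finset κ) (hs : 2 ≤ s.card) :
    ∃ i ∈ s, ∃ i' ∈ s, i ≠ i' ∧
      (∀ r ∈ s, ∀ r' ∈ s, r ≠ i → r' ≠ i → Parallel 𝕜 (a r i) (a r' i)) ∧
      (∀ r ∈ s, ∀ r' ∈ s, r ≠ i' → r' ≠ i' → Parallel 𝕜 (a r i') (a r' i')) := by
  classical
  induction s using Finset.strongInduction with
  | H s ih =>
  obtain hs2 | hs3 := hs.eq_or_lt
  · obtain ⟨x, y, hxy, rfl⟩ := Finset.card_eq_two.1 hs2.symm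
    refine ⟨x, by simp, y, by simp, hxy, ?_, ?_⟩
    all_goals
      intro r hr r' hr' h h'
      simp only [Finset.mem_insert, Finset.mem_singleton] at hr hr'
    · obtain rfl := hr.resolve_left h
      obtain rfl := hr'.resolve_left h'
      exact Parallel.refl _
    · obtain rfl := hr.resolve_right h
      obtain rfl := hr'.resolve_right h'
      exact Parallel.refl _
  · have key : ∀ j ∈ s, ∃ i ∈ s, i ≠ j ∧
        ∀ r ∈ s, ∀ r' ∈ s, r ≠ i → r' ≠ i → Parallel 𝕜 (a r i) (a r' i) := by
      intro j hj
      obtain ⟨i, hi, i', hi', hne, hl, hl'⟩ := ih _ (Finset.erase_ssubset hj)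
        (by rw [Finset.card_erase_of_mem hj]; omega)
      rw [Finset.mem_erase] at hi hi'
      have extend : ∀ l l', l ≠ l' → l' ≠ j → l' ∈ s →
          (∀ r ∈ s.erase j, ∀ r' ∈ s.erase j, r ≠ l → r' ≠ l → Parallel 𝕜 (a r l) (a r' l)) →
          Parallel 𝕜 (a l' l) (a j l) →
          ∀ r ∈ s, ∀ r' ∈ s, r ≠ l → r' ≠ l → Parallel 𝕜 (a r l) (a r' l) := by
        intro l l' hll' hl'j hl's hleaf hpar
        have h1 : ∀ r ∈ s, r ≠ l → Parallel 𝕜 (a r l) (a l' l) := by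
          intro r hr hrl
          obtain rfl | hrj := eq_or_ne r j
          · exact hpar.symm
          · exact hleaf r (Finset.mem_erase.2 ⟨hrj, hr⟩) l' (Finset.mem_erase.2 ⟨hl'j, hl's⟩)
              hrl hll'.symm
        exact fun r hr r' hr' h h' => (h1 r hr h).trans (h1 r' hr' h').symm
      obtain h | h := ha i i' j hne hi.1 hi'.1
      · exact ⟨i, hi.2, hi.1, extend i i' hne hi'.1 hi'.2 hl h⟩
      · exact ⟨i', hi'.2, hi'.1, extend i' i hne.symm hi.1 hi.2 hl' h⟩
    obtain ⟨j, hj⟩ : s.Nonempty := Finset.card_pos.1 (by omega)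
    obtain ⟨i, hi, -, hl⟩ := key j hj
    obtain ⟨i', hi', hne, hl'⟩ := key i hi
    exact ⟨i, hi, i', hi', hne.symm, hl, hl'⟩

/-- The coordinates of the `j`-th line on any finite nonempty set of other indices are those of a
point on one of the lines of this set. -/
theorem exists_incident (ha : IsTreelike 𝕜 a) (s : Finset κ) (hs : s.Nonempty) (j : κ)
    (hj : j ∉ s) : ∃ i ∈ s, ∀ r ∈ s, r ≠ i → Parallel 𝕜 (a i r) (a j r) := by
  classical
  induction s using Finset.strongInduction with
  | H s ih =>
  obtain h1 | h2 : s.card = 1 ∨ 2 ≤ s.card := by have := hs.card_pos; omega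
  · obtain ⟨x, rfl⟩ := Finset.card_eq_one.1 h1
    exact ⟨x, by simp, fun r hr hrx => absurd (Finset.mem_singleton.1 hr) hrx⟩
  · obtain ⟨i, hi, i', hi', hne, hl, -⟩ := ha.exists_two_leaves s h2
    have hji : j ≠ i := fun h => hj (h ▸ hi)
    by_cases hpar : Parallel 𝕜 (a i' i) (a j i)
    · obtain ⟨t, ht, htr⟩ := ih _ (Finset.erase_ssubset hi)
        ⟨i', Finset.mem_erase.2 ⟨hne.symm, hi'⟩⟩ (fun h => hj (Finset.mem_of_mem_erase h))
      rw [Finset.mem_erase] at ht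
      refine ⟨t, ht.2, fun r hr hrt => ?_⟩
      obtain rfl | hri := eq_or_ne r i
      · exact (hl t ht.2 i' hi' ht.1 hne.symm).trans hpar
      · exact htr r (Finset.mem_erase.2 ⟨hri, hr⟩) hrt
    · refine ⟨i, hi, fun r hr hri => ?_⟩
      refine (ha i r j hri.symm hji.symm fun h => hj (h ▸ hr)).resolve_left fun h => hpar ?_
      exact (hl i' hi' r hr hne.symm hri).trans h

/-- A tree-like family with at least two members has a leaf `j`, at which all other lines have the
same coordinate, and the `j`-th line meets another line. -/
theorem exists_leaf [Finite κ] (ha : IsTreelike 𝕜 a) (hκ : 2 ≤ Nat.card κ) :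
    ∃ j, (∀ r r', r ≠ j → r' ≠ j → Parallel 𝕜 (a r j) (a r' j)) ∧
      ∃ i, i ≠ j ∧ ∀ r, r ≠ i → r ≠ j → Parallel 𝕜 (a i r) (a j r) := by
  classical
  have := Fintype.ofFinite κ
  rw [Nat.card_eq_fintype_card] at hκ
  obtain ⟨j, -, i', -, hne, hl, -⟩ := ha.exists_two_leaves Finset.univ hκ
  obtain ⟨i, hi, h⟩ := ha.exists_incident (Finset.univ.erase j)
    ⟨i', Finset.mem_erase.2 ⟨hne.symm, Finset.mem_univ _⟩⟩ j (Finset.notMem_erase _ _)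
  exact ⟨j, fun r r' => hl r (Finset.mem_univ _) r' (Finset.mem_univ _), i, Finset.ne_of_mem_erase hi,
    fun r hri hrj => h r (Finset.mem_erase.2 ⟨hrj, Finset.mem_univ _⟩) hri⟩

end IsTreelike

end Treelike

/-! ### Symmetric tensors are spanned by powers -/

section Symmetric

variable {𝕜 : Type w} [Field 𝕜] {ι : Type} [Finite ι] {U : Type u} [AddCommGroup U] [Module 𝕜 U]

variable (𝕜) in
/-- The span of the powers `x ⊗ ⋯ ⊗ x`. -/
def powerSpan (ι : Type) (U : Type u) [AddCommGroup U] [Module 𝕜 U] :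
    Submodule 𝕜 (⨂[𝕜] _ : ι, U) :=
  Submodule.span 𝕜 (Set.range fun x : U => PiTensorProduct.tprod 𝕜 fun _ : ι => x)

/-- Polarization: `∑_σ x_{σ 1} ⊗ ⋯ ⊗ x_{σ d}` is the alternating sum of the powers of the partial
sums of the `x_i`. -/
theorem sum_perm_tprod_mem_powerSpan [Fintype ι] [DecidableEq ι] (x : ι → U) :
    ∑ σ : Equiv.Perm ι, PiTensorProduct.tprod 𝕜 (fun i => x (σ i)) ∈ powerSpan 𝕜 ι U := by
  have hpow : ∀ S : Finset ι, (PiTensorProduct.tprod 𝕜 fun _ : ι => ∑ j ∈ S, x j) =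
      ∑ r : ι → ι, if ∀ i, r i ∈ S then PiTensorProduct.tprod 𝕜 (fun i => x (r i)) else 0 := by
    intro S
    rw [MultilinearMap.map_sum_finset (PiTensorProduct.tprod 𝕜) (fun _ j => x j) (fun _ => S),
      ← Finset.sum_filter]
    refine Finset.sum_congr ?_ fun _ _ => rfl
    ext r
    simp
  -- For `r` missing a value `k`, toggling `k` pairs up the sets containing the image of `r`.
  have hcoef : ∀ r : ι → ι, ∑ S : Finset ι, (if ∀ i, r i ∈ S then (-1 : 𝕜) ^ S.card else 0) =
      if Function.Bijective r then (-1 : 𝕜) ^ Fintype.card ι else 0 := by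
    intro r
    split_ifs with hr
    · rw [Finset.sum_eq_single Finset.univ]
      · simp
      · intro S _ hS
        rw [if_neg]
        intro h
        refine hS (Finset.eq_univ_iff_forall.2 fun k => ?_)
        obtain ⟨i, rfl⟩ := hr.2 k
        exact h i
      · exact fun h => absurd (Finset.mem_univ _) h
    · obtain ⟨k, hk⟩ : ∃ k, ∀ i, r i ≠ k := by
        by_contra! h
        exact hr (Finite.surjective_iff_bijective.1 h)
      refine Finset.sum_involution (fun S _ => if k ∈ S then S.erase k else insert k S) ?_ ?_ ?_ ?_
      · intro S _
        by_cases hkS : k ∈ S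
        · have h1 : (∀ i, r i ∈ S.erase k) ↔ ∀ i, r i ∈ S := by simp [hk]
          have h2 : S.card = (S.erase k).card + 1 := (Finset.card_erase_add_one hkS).symm
          simp only [hkS, if_true, h1, h2, pow_succ]
          split_ifs <;> ring
        · have h1 : (∀ i, r i ∈ insert k S) ↔ ∀ i, r i ∈ S := by simp [hk]
          simp only [hkS, if_false, h1, Finset.card_insert_of_notMem hkS, pow_succ]
          split_ifs <;> ring
      · intro S _ _ h
        by_cases hkS : k ∈ S
        · rw [if_pos hkS] at h
          exact Finset.notMem_erase k S (h.symm ▸ hkS)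
        · rw [if_neg hkS] at h
          exact hkS (h ▸ Finset.mem_insert_self k S)
      · exact fun _ _ => Finset.mem_univ _
      · intro S _
        by_cases hkS : k ∈ S
        · simp [hkS]
        · simp [hkS]
  have hsum : ∑ S : Finset ι, (-1 : 𝕜) ^ S.card • (PiTensorProduct.tprod 𝕜 fun _ : ι => ∑ j ∈ S, x j)
      = (-1 : 𝕜) ^ Fintype.card ι •
        ∑ σ : Equiv.Perm ι, PiTensorProduct.tprod 𝕜 (fun i => x (σ i)) := by
    calc _ = ∑ r : ι → ι, (∑ S : Finset ι, (if ∀ i, r i ∈ S then (-1 : 𝕜) ^ S.card else 0)) •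
            PiTensorProduct.tprod 𝕜 (fun i => x (r i)) := by
          simp_rw [hpow, Finset.smul_sum, Finset.sum_smul]
          rw [Finset.sum_comm]
          refine Finset.sum_congr rfl fun r _ => Finset.sum_congr rfl fun S _ => ?_
          split_ifs <;> simp
      _ = ∑ r : ι → ι with Function.Bijective r,
            (-1 : 𝕜) ^ Fintype.card ι • PiTensorProduct.tprod 𝕜 (fun i => x (r i)) := by
          rw [Finset.sum_filter]
          refine Finset.sum_congr rfl fun r _ => ?_
          rw [hcoef]
          split_ifs <;> simp
      _ = _ := by
          rw [Finset.smul_sum]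
          symm
          refine Finset.sum_bij (fun σ _ => ⇑σ) (fun σ _ => by simp)
            (fun σ _ τ _ h => Equiv.coe_fn_injective h) (fun r hr => ?_) fun _ _ => rfl
          exact ⟨Equiv.ofBijective r (by simpa using hr), Finset.mem_univ _, rfl⟩
  have hmem : (-1 : 𝕜) ^ Fintype.card ι •
      ∑ σ : Equiv.Perm ι, PiTensorProduct.tprod 𝕜 (fun i => x (σ i)) ∈ powerSpan 𝕜 ι U := by
    rw [← hsum]
    exact Submodule.sum_mem _ fun S _ => Submodule.smul_mem _ _ (Submodule.subset_span ⟨_, rfl⟩)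
  exact (Submodule.smul_mem_iff _ (pow_ne_zero _ (neg_ne_zero.2 one_ne_zero))).1 hmem

theorem symTensors_eq_powerSpan [CharZero 𝕜] : symTensors 𝕜 ι U = powerSpan 𝕜 ι U := by
  classical
  have := Fintype.ofFinite ι
  refine le_antisymm (fun t ht => ?_) ?_
  · let sym : (⨂[𝕜] _ : ι, U) →ₗ[𝕜] ⨂[𝕜] _ : ι, U :=
      ∑ σ : Equiv.Perm ι, (PiTensorProduct.reindex 𝕜 (fun _ : ι => U) σ).toLinearMap
    have hrange : ∀ z, sym z ∈ powerSpan 𝕜 ι U := by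
      intro z
      have hz : z ∈ Submodule.span 𝕜 (Set.range (PiTensorProduct.tprod 𝕜 (s := fun _ : ι => U))) := by
        rw [PiTensorProduct.span_tprod_eq_top]; trivial
      induction hz using Submodule.span_induction with
      | mem z hz =>
        obtain ⟨x, rfl⟩ := hz
        have : sym (PiTensorProduct.tprod 𝕜 x) =
            ∑ σ : Equiv.Perm ι, PiTensorProduct.tprod 𝕜 (fun i => x (σ i)) := by
          simp only [sym, LinearMap.sum_apply, LinearEquiv.coe_coe]
          refine Fintype.sum_equiv (Equiv.inv (Equiv.Perm ι)) _ _ fun σ => ?_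
          exact PiTensorProduct.reindex_tprod σ x
        rw [this]
        exact sum_perm_tprod_mem_powerSpan x
      | zero => rw [map_zero]; exact Submodule.zero_mem _
      | add y z _ _ hy hz => rw [map_add]; exact Submodule.add_mem _ hy hz
      | smul c z _ hz => rw [map_smul]; exact Submodule.smul_mem _ c hz
    have h := hrange t
    have hst : sym t = (Fintype.card (Equiv.Perm ι) : 𝕜) • t := by
      simp only [sym, LinearMap.sum_apply, LinearEquiv.coe_coe]
      rw [Finset.sum_congr rfl fun σ _ => ht σ, Finset.sum_const, Finset.card_univ,
        Nat.cast_smul_eq_nsmul]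
    rw [hst] at h
    exact (Submodule.smul_mem_iff _ (Nat.cast_ne_zero.2 Fintype.card_ne_zero)).1 h
  · rw [powerSpan, Submodule.span_le]
    rintro _ ⟨x, rfl⟩ σ
    exact PiTensorProduct.reindex_tprod σ fun _ => x

/-- For a plane `U`, the powers `(s e₀ + t e₁)^{⊗ d}` are combinations of the `d + 1` tensors
`∑_{|S| = k} e_S`. -/
theorem finrank_powerSpan_le (hU : finrank 𝕜 U = 2) :
    finrank 𝕜 (powerSpan 𝕜 ι U) ≤ Nat.card ι + 1 := by
  classical
  have := Fintype.ofFinite ι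
  have : Module.Finite 𝕜 U := Module.finite_of_finrank_pos (by omega)
  let b := finBasisOfFinrankEq 𝕜 U hU
  let e : Fin (Fintype.card ι + 1) → ⨂[𝕜] _ : ι, U := fun k =>
    ∑ S : Finset ι with S.card = (k : ℕ), PiTensorProduct.tprod 𝕜 (S.piecewise (fun _ => b 0) fun _ => b 1)
  have hle : powerSpan 𝕜 ι U ≤ Submodule.span 𝕜 (Set.range e) := by
    rw [powerSpan, Submodule.span_le]
    rintro _ ⟨x, rfl⟩
    have hx : x = b.repr x 0 • b 0 + b.repr x 1 • b 1 := by
      conv_lhs => rw [← b.sum_repr x, Fin.sum_univ_two]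
    generalize b.repr x 0 = s at hx
    generalize b.repr x 1 = t at hx
    subst hx
    have hexp : (PiTensorProduct.tprod 𝕜 fun _ : ι => s • b 0 + t • b 1) =
        ∑ k : Fin (Fintype.card ι + 1), (s ^ (k : ℕ) * t ^ (Fintype.card ι - k)) • e k := by
      refine (MultilinearMap.map_add_univ (PiTensorProduct.tprod 𝕜) (fun _ => s • b 0)
        fun _ => t • b 1).trans ?_
      simp only [e, Finset.smul_sum]
      rw [← Finset.sum_fiberwise_of_maps_to (s := Finset.univ) (t := Finset.univ)
        (g := fun S : Finset ι => (⟨S.card, Nat.lt_succ_of_le S.card_le_univ⟩ :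
          Fin (Fintype.card ι + 1))) (fun _ _ => Finset.mem_univ _)]
      refine Finset.sum_congr rfl fun k _ => Finset.sum_congr ?_ fun S hS => ?_
      · ext S
        simp [Fin.ext_iff]
      · have hSk : S.card = k := by simpa [Fin.ext_iff] using hS
        have hsm : (S.piecewise (fun _ => s • b 0) fun _ => t • b 1) =
            fun i => S.piecewise (fun _ => s) (fun _ => t) i •
              S.piecewise (fun _ => b 0) (fun _ => b 1) i := by
          funext i
          by_cases hi : i ∈ S <;> simp [hi]
        rw [hsm, MultilinearMap.map_smul_univ, Finset.prod_piecewise]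
        congr 1
        simp [hSk, Finset.card_sdiff]
    simp only [SetLike.mem_coe, hexp]
    exact Submodule.sum_mem _ fun k _ => Submodule.smul_mem _ _ (Submodule.subset_span ⟨k, rfl⟩)
  calc _ ≤ finrank 𝕜 (Submodule.span 𝕜 (Set.range e)) := Submodule.finrank_mono hle
    _ ≤ Fintype.card (Fin (Fintype.card ι + 1)) := finrank_range_le_card e
    _ = _ := by rw [Fintype.card_fin, Nat.card_eq_fintype_card]

end Symmetric

/-! ### Transport of spans of lines -/

section Transport

theorem tprod_ne_zero {𝕜 : Type w} [Field 𝕜] {ι : Type*} [Finite ι] {U : ι → Type*}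
    [∀ i, AddCommGroup (U i)] [∀ i, Module 𝕜 (U i)] {f : ∀ i, U i} (hf : ∀ i, f i ≠ 0) :
    PiTensorProduct.tprod 𝕜 f ≠ 0 := by
  have := Fintype.ofFinite ι
  have hdual : ∀ i, ∃ m : Dual 𝕜 (U i), m (f i) ≠ 0 := by
    intro i
    by_contra! h
    exact hf i ((Module.forall_dual_apply_eq_zero_iff 𝕜 (f i)).1 h)
  choose m hm using hdual
  intro h
  have h' := PiTensorProduct.dualDistrib_apply m f
  rw [h, map_zero, eq_comm, Finset.prod_eq_zero_iff] at h'
  obtain ⟨i, -, hi⟩ := h'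
  exact hm i hi

/-- The subspaces `H ⊗ t` and `s ⊗ K` have `s ⊗ t` in common. -/
theorem finrank_map₂_sup_add_one_le {𝕜 : Type w} [Field 𝕜] {M N P : Type*} [AddCommGroup M]
    [Module 𝕜 M] [AddCommGroup N] [Module 𝕜 N] [AddCommGroup P] [Module 𝕜 P]
    (B : M →ₗ[𝕜] N →ₗ[𝕜] P) (H : Submodule 𝕜 M) (K : Submodule 𝕜 N) [Module.Finite 𝕜 H]
    [Module.Finite 𝕜 K] {s : M} {t : N} (hs : s ∈ H) (ht : t ∈ K) (hst : B s t ≠ 0) :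
    finrank 𝕜 ↥(Submodule.map₂ B H (Submodule.span 𝕜 {t}) ⊔
      Submodule.map₂ B (Submodule.span 𝕜 {s}) K) + 1 ≤ finrank 𝕜 H + finrank 𝕜 K := by
  rw [Submodule.map₂_span_singleton_eq_map_flip, Submodule.map₂_span_singleton_eq_map]
  have h1 : finrank 𝕜 (H.map (B.flip t)) ≤ finrank 𝕜 H := Submodule.finrank_map_le _ _
  have h2 : finrank 𝕜 (K.map (B s)) ≤ finrank 𝕜 K := Submodule.finrank_map_le _ _
  have h3 : 1 ≤ finrank 𝕜 ↥(H.map (B.flip t) ⊓ K.map (B s)) := by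
    have hmem : B s t ∈ H.map (B.flip t) ⊓ K.map (B s) := ⟨⟨s, hs, rfl⟩, ⟨t, ht, rfl⟩⟩
    have : Nontrivial ↥(H.map (B.flip t) ⊓ K.map (B s)) :=
      ⟨⟨⟨_, hmem⟩, 0, fun h => hst (congrArg Subtype.val h)⟩⟩
    exact finrank_pos
  have h4 := Submodule.finrank_sup_add_finrank_inf_eq (H.map (B.flip t)) (K.map (B s))
  omega

theorem lineSpan_congr {𝕜 : Type w} [Field 𝕜] {W : Type*} [AddCommGroup W] [Module 𝕜 W]
    {ι κ : Type} [Finite ι] (g : ι → κ) {a a' : κ → ι → W}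
    (h : ∀ j i, g i ≠ j → Parallel 𝕜 (a j i) (a' j i)) : lineSpan 𝕜 g a = lineSpan 𝕜 g a' := by
  have key : ∀ {a a' : κ → ι → W}, (∀ j i, g i ≠ j → Parallel 𝕜 (a j i) (a' j i)) →
      lineSpan 𝕜 g a ≤ lineSpan 𝕜 g a' := by
    intro a a' h
    rw [lineSpan, Submodule.span_le]
    rintro _ ⟨⟨j, x⟩, rfl⟩
    have hpar : Parallel 𝕜 (PiTensorProduct.tprod 𝕜 (lineVec g a' j x))
        (PiTensorProduct.tprod 𝕜 (lineVec g a j x)) := by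
      refine Parallel.tprod fun i => ?_
      by_cases hi : g i = j
      · rw [lineVec_of_eq hi, lineVec_of_eq hi]
        exact Parallel.refl _
      · rw [lineVec_of_ne hi, lineVec_of_ne hi]
        exact (h j i hi).symm
    obtain ⟨c, -, hc⟩ := hpar
    simp only [SetLike.mem_coe, hc]
    exact Submodule.smul_mem _ _ (tprod_lineVec_mem g a' j x)
  exact le_antisymm (key h) (key fun j i hi => (h j i hi).symm)

variable {𝕜 : Type w} [RCLike 𝕜]

theorem slotIso_tprod {ι κ : Type} {U : ι → Type u} [∀ i, AddCommGroup (U i)]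
    [∀ i, Module 𝕜 (U i)] {U' : κ → Type u} [∀ i, AddCommGroup (U' i)] [∀ i, Module 𝕜 (U' i)]
    (σ : κ ≃ ι) (f : ∀ j, U (σ j) ≃ₗ[𝕜] U' j) (x : ∀ i, U i) :
    slotIso σ f (PiTensorProduct.tprod 𝕜 x) = PiTensorProduct.tprod 𝕜 fun j => f j (x (σ j)) := by
  rw [slotIso, LinearEquiv.trans_apply, PiTensorProduct.reindex_tprod]
  exact PiTensorProduct.congr_tprod f _

/-- The span of lines given by `g` and `a`, transported to slots carrying the spaces `U i` along
isomorphisms `F i : W ≃ U i`. -/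
noncomputable def lineSpanIn {W : Type*} [AddCommGroup W] [Module 𝕜 W] {ι κ : Type} {U : ι → Type*}
    [∀ i, AddCommGroup (U i)] [∀ i, Module 𝕜 (U i)] (g : ι → κ) (a : κ → ι → W)
    (F : ∀ i, W ≃ₗ[𝕜] U i) : Submodule 𝕜 (⨂[𝕜] i, U i) :=
  (lineSpan 𝕜 g a).map (PiTensorProduct.congr F).toLinearMap

section

variable {W : Type*} [AddCommGroup W] [Module 𝕜 W] {ι κ : Type} {U : ι → Type*}
  [∀ i, AddCommGroup (U i)] [∀ i, Module 𝕜 (U i)]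

theorem lineSpanIn_eq_span (g : ι → κ) (a : κ → ι → W) (F : ∀ i, W ≃ₗ[𝕜] U i) :
    lineSpanIn g a F = Submodule.span 𝕜 (Set.range fun p : κ × W =>
      PiTensorProduct.tprod 𝕜 fun i => F i (lineVec g a p.1 p.2 i)) := by
  rw [lineSpanIn, lineSpan, Submodule.map_span, ← Set.range_comp]
  congr 2
  funext p
  exact PiTensorProduct.congr_tprod F _

theorem tprod_mem_lineSpanIn (g : ι → κ) (a : κ → ι → W) (F : ∀ i, W ≃ₗ[𝕜] U i) (j : κ) (x : W) :
    (PiTensorProduct.tprod 𝕜 fun i => F i (lineVec g a j x i)) ∈ lineSpanIn g a F := by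
  rw [lineSpanIn_eq_span]
  exact Submodule.subset_span ⟨(j, x), rfl⟩

theorem lineSpanIn_le {g : ι → κ} {a : κ → ι → W} {F : ∀ i, W ≃ₗ[𝕜] U i}
    {H : Submodule 𝕜 (⨂[𝕜] i, U i)}
    (h : ∀ j x, (PiTensorProduct.tprod 𝕜 fun i => F i (lineVec g a j x i)) ∈ H) :
    lineSpanIn g a F ≤ H := by
  rw [lineSpanIn_eq_span, Submodule.span_le]
  rintro _ ⟨⟨j, x⟩, rfl⟩
  exact h j x

theorem finrank_lineSpanIn (g : ι → κ) (a : κ → ι → W) (F : ∀ i, W ≃ₗ[𝕜] U i) :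
    finrank 𝕜 (lineSpanIn g a F) = finrank 𝕜 (lineSpan 𝕜 g a) :=
  LinearEquiv.finrank_map_eq _ _

theorem lineSpanIn_refl (g : ι → κ) (a : κ → ι → W) :
    lineSpanIn g a (fun _ => LinearEquiv.refl 𝕜 W) = lineSpan 𝕜 g a :=
  lineSpanIn_eq_span g a _

end

theorem map_slotIso_lineSpanIn {W : Type*} [AddCommGroup W] [Module 𝕜 W] {ι ι' κ : Type}
    {U : ι → Type u} [∀ i, AddCommGroup (U i)] [∀ i, Module 𝕜 (U i)] {U' : ι' → Type u}
    [∀ i, AddCommGroup (U' i)] [∀ i, Module 𝕜 (U' i)] (σ : ι' ≃ ι)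
    (f : ∀ j, U (σ j) ≃ₗ[𝕜] U' j) (g : ι → κ) (a : κ → ι → W) (F : ∀ i, W ≃ₗ[𝕜] U i) :
    (lineSpanIn g a F).map (slotIso σ f).toLinearMap =
      lineSpanIn (g ∘ σ) (fun j k => a j (σ k)) (fun k => (F (σ k)).trans (f k)) := by
  rw [lineSpanIn_eq_span, lineSpanIn_eq_span, Submodule.map_span, ← Set.range_comp]
  congr 2
  funext p
  exact slotIso_tprod σ f _

end Transport

/-! ### Segre-Veronese spans in normal form -/

section NormalForm

variable {𝕜 : Type w} [RCLike 𝕜]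

/-- A subspace is a Segre-Veronese span if it has the form `lineSpanIn g a F`, with nonempty groups
of slots and nonzero vectors, and has the minimal dimension `m + 1`. -/
def IsSegreVeroneseSpan {ι : Type} {U : ι → Type u} [∀ i, AddCommGroup (U i)]
    [∀ i, Module 𝕜 (U i)] (H : Submodule 𝕜 (⨂[𝕜] i, U i)) : Prop :=
  ∃ (κ : Type) (_ : Finite κ) (W : Type u) (_ : AddCommGroup W) (_ : Module 𝕜 W) (g : ι → κ)
    (a : κ → ι → W) (F : ∀ i, W ≃ₗ[𝕜] U i), finrank 𝕜 W = 2 ∧ Function.Surjective g ∧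
    (∀ j i, g i ≠ j → a j i ≠ 0) ∧ H = lineSpanIn g a F ∧ finrank 𝕜 H = Nat.card ι + 1

/-- A subspace is a tree span if it has the form `lineSpanIn g a F` with vectors `a j i` which
depend only on the group of the slot `i`, and form a tree-like family. -/
def IsTreeSpan {ι : Type} {U : ι → Type u} [∀ i, AddCommGroup (U i)]
    [∀ i, Module 𝕜 (U i)] (H : Submodule 𝕜 (⨂[𝕜] i, U i)) : Prop :=
  ∃ (κ : Type) (_ : Finite κ) (_ : Nonempty κ) (W : Type u) (_ : AddCommGroup W) (_ : Module 𝕜 W)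
    (g : ι → κ) (a : κ → κ → W) (F : ∀ i, W ≃ₗ[𝕜] U i), finrank 𝕜 W = 2 ∧ Function.Surjective g ∧
    (∀ j r, r ≠ j → a j r ≠ 0) ∧ IsTreelike 𝕜 (fun j r => a j r) ∧
    H = lineSpanIn g (fun j i => a j (g i)) F

theorem nonempty_of_finrank_lineSpan {W : Type*} [AddCommGroup W] [Module 𝕜 W] {ι κ : Type}
    {g : ι → κ} {a : κ → ι → W} (h : finrank 𝕜 (lineSpan 𝕜 g a) = Nat.card ι + 1) :
    Nonempty κ := by
  by_contra hκ
  rw [not_nonempty_iff] at hκ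
  have : lineSpan 𝕜 g a = ⊥ := by rw [lineSpan, Set.range_eq_empty, Submodule.span_empty]
  rw [this, finrank_bot] at h
  omega

/-- The dimension condition makes the vectors `a j i` depend, up to scalars, only on the group of
`i`, and makes them tree-like. -/
theorem IsSegreVeroneseSpan.isTreeSpan {ι : Type} [Finite ι] {U : ι → Type u}
    [∀ i, AddCommGroup (U i)] [∀ i, Module 𝕜 (U i)] {H : Submodule 𝕜 (⨂[𝕜] i, U i)}
    (hH : IsSegreVeroneseSpan H) : IsTreeSpan H := by
  obtain ⟨κ, _, W, _, _, g, a, F, hW, hg, ha, rfl, hdim⟩ := hH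
  rw [finrank_lineSpanIn] at hdim
  obtain ⟨c, hc⟩ := hg.hasRightInverse
  refine ⟨κ, inferInstance, nonempty_of_finrank_lineSpan hdim, W, _, _, g, fun j r => a j (c r), F,
    hW, hg, fun j r h => ha j _ (by rwa [hc]), fun i i' j h1 h2 h3 => ?_, ?_⟩
  · have h := parallel_or_parallel hW ha hdim (s := c i) (s' := c i') (j := j) (by rwa [hc, hc])
      (by rwa [hc]) (by rwa [hc])
    rwa [hc, hc] at h
  · rw [lineSpanIn, lineSpanIn, lineSpan_congr g (a' := fun j i => a j (c (g i)))]
    exact fun j i hi => parallel_of_same_group hW ha hdim (hc (g i)).symm hi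

theorem isSegreVeroneseSpan_map_slotIso {ι κ : Type} {U : ι → Type u} [∀ i, AddCommGroup (U i)]
    [∀ i, Module 𝕜 (U i)] {U' : κ → Type u} [∀ i, AddCommGroup (U' i)] [∀ i, Module 𝕜 (U' i)]
    (σ : κ ≃ ι) (f : ∀ j, U (σ j) ≃ₗ[𝕜] U' j) {H : Submodule 𝕜 (⨂[𝕜] i, U i)}
    (hH : IsSegreVeroneseSpan H) : IsSegreVeroneseSpan (H.map (slotIso σ f).toLinearMap) := by
  obtain ⟨κ', _, W, _, _, g, a, F, hW, hg, ha, rfl, hdim⟩ := hH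
  refine ⟨κ', inferInstance, W, _, _, g ∘ σ, fun j k => a j (σ k), _, hW,
    hg.comp σ.surjective, fun j k => ha j (σ k), map_slotIso_lineSpanIn σ f g a F, ?_⟩
  rw [LinearEquiv.finrank_map_eq, hdim, Nat.card_congr σ]

theorem isSegreVeroneseSpan_of_map_slotIso {ι κ : Type} {U : ι → Type u} [∀ i, AddCommGroup (U i)]
    [∀ i, Module 𝕜 (U i)] {U' : κ → Type u} [∀ i, AddCommGroup (U' i)] [∀ i, Module 𝕜 (U' i)]
    (σ : κ ≃ ι) (f : ∀ j, U (σ j) ≃ₗ[𝕜] U' j) {H : Submodule 𝕜 (⨂[𝕜] i, U i)}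
    (hH : IsSegreVeroneseSpan (H.map (slotIso σ f).toLinearMap)) : IsSegreVeroneseSpan H := by
  obtain ⟨κ', _, W, _, _, g, a, F, hW, hg, ha, h, hdim⟩ := hH
  obtain ⟨F', hF'⟩ : ∃ F' : ∀ i, W ≃ₗ[𝕜] U i, ∀ k, F' (σ k) = (F k).trans (f k).symm :=
    ⟨Equiv.piCongrLeft (fun i => W ≃ₗ[𝕜] U i) σ fun k => (F k).trans (f k).symm,
      fun k => Equiv.piCongrLeft_apply_apply (fun i => W ≃ₗ[𝕜] U i) σ _ k⟩
  refine ⟨κ', inferInstance, W, _, _, g ∘ σ.symm, fun j i => a j (σ.symm i), F', hW,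
    hg.comp σ.symm.surjective, fun j i => ha j (σ.symm i), ?_, ?_⟩
  · refine Submodule.map_injective_of_injective (slotIso σ f).injective ?_
    refine Eq.trans ?_ (map_slotIso_lineSpanIn σ f _ _ _).symm
    refine h.trans ?_
    have h1 : (g ∘ σ.symm) ∘ σ = g := by funext k; simp
    have h2 : (fun j k => a j (σ.symm (σ k))) = a := by funext j k; simp
    have h3 : (fun k => (F' (σ k)).trans (f k)) = F := by
      funext k
      rw [hF', LinearEquiv.trans_assoc, LinearEquiv.symm_trans_self, LinearEquiv.trans_refl]
    rw [h1, h2, h3]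
  · rw [LinearEquiv.finrank_map_eq] at hdim
    rw [hdim, Nat.card_congr σ]

theorem lineSpan_unit {W : Type u} [AddCommGroup W] [Module 𝕜 W] {ι κ : Type} [Unique κ]
    (g : ι → κ) (a : κ → ι → W) : lineSpan 𝕜 g a = powerSpan 𝕜 ι W := by
  have h : ∀ j x, lineVec g a j x = fun _ => x := fun j x => funext fun i =>
    lineVec_of_eq (Subsingleton.elim _ _)
  refine le_antisymm ?_ ?_
  · rw [lineSpan, Submodule.span_le]
    rintro _ ⟨⟨j, x⟩, rfl⟩
    simp only [h]
    exact Submodule.subset_span ⟨x, rfl⟩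
  · rw [powerSpan, Submodule.span_le]
    rintro _ ⟨x, rfl⟩
    simp only [← h default x]
    exact tprod_lineVec_mem g a default x

theorem isSegreVeroneseSpan_symTensors {ι : Type} [Finite ι] [Nonempty ι] {W : Type u}
    [AddCommGroup W] [Module 𝕜 W] (hW : finrank 𝕜 W = 2) :
    IsSegreVeroneseSpan (symTensors 𝕜 ι W) := by
  have ha : ∀ (j : Unit) (i : ι), () ≠ j → (fun (_ : Unit) (_ : ι) => (0 : W)) j i ≠ 0 :=
    fun j _ h => absurd (Subsingleton.elim _ _) h
  have heq : symTensors 𝕜 ι W = lineSpan 𝕜 (fun _ : ι => ()) fun _ _ => (0 : W) := by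
    rw [lineSpan_unit, symTensors_eq_powerSpan]
  refine ⟨Unit, inferInstance, W, _, _, fun _ => (), fun _ _ => 0, fun _ => LinearEquiv.refl 𝕜 W, hW,
    fun _ => ⟨Classical.arbitrary ι, rfl⟩, ha, by rw [lineSpanIn_refl, heq], le_antisymm ?_ ?_⟩
  · rw [symTensors_eq_powerSpan]
    exact finrank_powerSpan_le hW
  · rw [heq]
    exact card_add_one_le_finrank_lineSpan hW _ _ ha

theorem isSegreVeroneseSpan_product {ι κ : Type} [Finite ι] [Finite κ] {U : ι ⊕ κ → Type u}
    [∀ i, AddCommGroup (U i)] [∀ i, Module 𝕜 (U i)]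
    {H S : Submodule 𝕜 (⨂[𝕜] i : ι, U (.inl i))} {K T : Submodule 𝕜 (⨂[𝕜] i : κ, U (.inr i))}
    (hH : IsSegreVeroneseSpan H) (hK : IsSegreVeroneseSpan K) (hSH : S ≤ H)
    (hS : IsDecomposableLine S) (hTK : T ≤ K) (hT : IsDecomposableLine T) :
    IsSegreVeroneseSpan (Submodule.map₂ (tensorMul 𝕜 U) H T ⊔
      Submodule.map₂ (tensorMul 𝕜 U) S K) := by
  obtain ⟨κ₁, _, W₁, _, _, g₁, a₁, F₁, hW₁, hg₁, ha₁, hH', hHdim⟩ := hH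
  obtain ⟨κ₂, _, W₂, _, _, g₂, a₂, F₂, hW₂, hg₂, ha₂, hK', hKdim⟩ := hK
  obtain ⟨s, hs, rfl⟩ := hS
  obtain ⟨t, ht, rfl⟩ := hT
  have : Module.Finite 𝕜 W₁ := Module.finite_of_finrank_pos (by omega)
  have : Module.Finite 𝕜 W₂ := Module.finite_of_finrank_pos (by omega)
  have : Module.Finite 𝕜 H := Module.finite_of_finrank_pos (by rw [hHdim]; exact Nat.succ_pos _)
  have : Module.Finite 𝕜 K := Module.finite_of_finrank_pos (by rw [hKdim]; exact Nat.succ_pos _)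
  have : Nonempty κ₁ := by
    rw [hH', finrank_lineSpanIn] at hHdim
    exact nonempty_of_finrank_lineSpan hHdim
  have e : W₁ ≃ₗ[𝕜] W₂ := LinearEquiv.ofFinrankEq W₁ W₂ (hW₁.trans hW₂.symm)
  let F : ∀ i : ι ⊕ κ, W₁ ≃ₗ[𝕜] U i := fun i => match i with
    | .inl i => F₁ i
    | .inr i => e.trans (F₂ i)
  let a : κ₁ ⊕ κ₂ → ι ⊕ κ → W₁ := fun j i => match j, i with
    | .inl j, .inl i => a₁ j i
    | .inl _, .inr i => (F (.inr i)).symm (t i)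
    | .inr _, .inl i => (F (.inl i)).symm (s i)
    | .inr j, .inr i => e.symm (a₂ j i)
  have ha : ∀ j i, Sum.map g₁ g₂ i ≠ j → a j i ≠ 0 := by
    rintro (j | j) (i | i) h
    · exact ha₁ j i fun h' => h (congrArg Sum.inl h')
    · exact (LinearEquiv.map_ne_zero_iff _).2 (ht i)
    · exact (LinearEquiv.map_ne_zero_iff _).2 (hs i)
    · exact (LinearEquiv.map_ne_zero_iff _).2 (ha₂ j i fun h' => h (congrArg Sum.inr h'))
  have hl : ∀ j x, (PiTensorProduct.tprod 𝕜 fun i => F i (lineVec (Sum.map g₁ g₂) a (.inl j) x i)) =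
      tensorMul 𝕜 U (PiTensorProduct.tprod 𝕜 fun i => F₁ i (lineVec g₁ a₁ j x i))
        (PiTensorProduct.tprod 𝕜 t) := by
    intro j x
    rw [← tensorMul_tprod]
    congr 2
    · congr 1
      funext i
      by_cases h : g₁ i = j
      · rw [lineVec_of_eq h, lineVec_of_eq (g := Sum.map g₁ g₂) (i := .inl i) (congrArg Sum.inl h)]
      · rw [lineVec_of_ne h, lineVec_of_ne (g := Sum.map g₁ g₂) (i := .inl i)
          fun h' => h (Sum.inl_injective h')]
    · funext i
      rw [lineVec_of_ne (by simp)]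
      exact (F (.inr i)).apply_symm_apply (t i)
  have hr : ∀ j x, (PiTensorProduct.tprod 𝕜 fun i => F i (lineVec (Sum.map g₁ g₂) a (.inr j) x i)) =
      tensorMul 𝕜 U (PiTensorProduct.tprod 𝕜 s)
        (PiTensorProduct.tprod 𝕜 fun i => F₂ i (lineVec g₂ a₂ j (e x) i)) := by
    intro j x
    rw [← tensorMul_tprod]
    congr 2
    · congr 1
      funext i
      rw [lineVec_of_ne (by simp)]
      exact (F (.inl i)).apply_symm_apply (s i)
    · funext i
      by_cases h : g₂ i = j
      · rw [lineVec_of_eq h, lineVec_of_eq (g := Sum.map g₁ g₂) (i := .inr i) (congrArg Sum.inr h)]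
        rfl
      · rw [lineVec_of_ne h, lineVec_of_ne (g := Sum.map g₁ g₂) (i := .inr i)
          fun h' => h (Sum.inr_injective h')]
        exact congrArg (F₂ i) (e.apply_symm_apply _)
  have hsH : PiTensorProduct.tprod 𝕜 s ∈ H := hSH (Submodule.mem_span_singleton_self _)
  have htK : PiTensorProduct.tprod 𝕜 t ∈ K := hTK (Submodule.mem_span_singleton_self _)
  have heq : Submodule.map₂ (tensorMul 𝕜 U) H (Submodule.span 𝕜 {PiTensorProduct.tprod 𝕜 t}) ⊔
      Submodule.map₂ (tensorMul 𝕜 U) (Submodule.span 𝕜 {PiTensorProduct.tprod 𝕜 s}) K =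
      lineSpanIn (Sum.map g₁ g₂) a F := by
    refine le_antisymm (sup_le ?_ ?_) (lineSpanIn_le ?_)
    · rw [Submodule.map₂_span_singleton_eq_map_flip, Submodule.map_le_iff_le_comap, hH']
      refine lineSpanIn_le fun j x => ?_
      rw [Submodule.mem_comap, LinearMap.flip_apply, ← hl]
      exact tprod_mem_lineSpanIn _ _ _ _ _
    · rw [Submodule.map₂_span_singleton_eq_map, Submodule.map_le_iff_le_comap, hK']
      refine lineSpanIn_le fun j x => ?_
      rw [Submodule.mem_comap, ← e.apply_symm_apply x, ← hr]
      exact tprod_mem_lineSpanIn _ _ _ _ _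
    · rintro (j | j) x
      · rw [hl]
        refine Submodule.mem_sup_left (Submodule.apply_mem_map₂ _ ?_
          (Submodule.mem_span_singleton_self _))
        rw [hH']
        exact tprod_mem_lineSpanIn _ _ _ _ _
      · rw [hr]
        refine Submodule.mem_sup_right (Submodule.apply_mem_map₂ _
          (Submodule.mem_span_singleton_self _) ?_)
        rw [hK']
        exact tprod_mem_lineSpanIn _ _ _ _ _
  refine ⟨κ₁ ⊕ κ₂, inferInstance, W₁, _, _, Sum.map g₁ g₂, a, F, hW₁,
    Sum.map_surjective.2 ⟨hg₁, hg₂⟩, ha, heq, le_antisymm ?_ ?_⟩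
  · have hst : tensorMul 𝕜 U (PiTensorProduct.tprod 𝕜 s) (PiTensorProduct.tprod 𝕜 t) ≠ 0 := by
      let f : ∀ i, U i := fun i => match i with
        | .inl i => s i
        | .inr i => t i
      have hf : ∀ i, f i ≠ 0 := by rintro (i | i); exacts [hs i, ht i]
      have h := tensorMul_tprod 𝕜 U f
      exact fun h0 => tprod_ne_zero hf (h.symm.trans h0)
    have h := finrank_map₂_sup_add_one_le (tensorMul 𝕜 U) H K hsH htK hst
    rw [hHdim, hKdim] at h
    rw [Nat.card_sum]
    omega
  · rw [heq, finrank_lineSpanIn]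
    exact card_add_one_le_finrank_lineSpan hW₁ _ _ ha

theorem isSegreVeroneseSpan_of_isIteratedVeroneseProductSubspace {ι : Type} {U : ι → Type u}
    [∀ i, AddCommGroup (U i)] [∀ i, Module 𝕜 (U i)] {H : Submodule 𝕜 (⨂[𝕜] i, U i)}
    (hH : IsIteratedVeroneseProductSubspace H) : Finite ι ∧ IsSegreVeroneseSpan H := by
  induction hH with
  | veronese d hd W hW =>
    have : Nonempty (Fin d) := ⟨⟨0, hd⟩⟩
    exact ⟨inferInstance, isSegreVeroneseSpan_symTensors hW⟩
  | product H S K T hH hK hSH hS hTK hT ihH ihK =>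
    obtain ⟨_, ihH⟩ := ihH
    obtain ⟨_, ihK⟩ := ihK
    exact ⟨inferInstance, isSegreVeroneseSpan_product ihH ihK hSH hS hTK hT⟩
  | iso σ f H hH ih =>
    obtain ⟨_, ih⟩ := ih
    exact ⟨Finite.of_equiv _ σ.symm, isSegreVeroneseSpan_map_slotIso σ f ih⟩

end NormalForm

/-! ### Tree spans are iterated products -/

section Iterated

theorem Parallel.mem {𝕜 : Type w} [Field 𝕜] {M : Type*} [AddCommGroup M] [Module 𝕜 M] {x y : M}
    (h : Parallel 𝕜 x y) {p : Submodule 𝕜 M} (hx : x ∈ p) : y ∈ p := by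
  obtain ⟨c, -, rfl⟩ := h
  exact p.smul_mem c hx

variable {𝕜 : Type w} [RCLike 𝕜]

theorem isIteratedVeroneseProductSubspace_symTensors {ι : Type} [Finite ι] [Nonempty ι] {W : Type u}
    [AddCommGroup W] [Module 𝕜 W] (hW : finrank 𝕜 W = 2) :
    IsIteratedVeroneseProductSubspace (U := fun _ : ι => W) (symTensors 𝕜 ι W) := by
  have h := IsIteratedVeroneseProductSubspace.iso (U' := fun _ : ι => W) (Finite.equivFin ι)
    (fun _ => LinearEquiv.refl 𝕜 W) _ (.veronese (𝕜 := 𝕜) (Nat.card ι) Nat.card_pos W hW)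
  rw [symTensors_eq_powerSpan, ← lineSpan_unit (fun _ => ()) (fun _ _ => 0), ← lineSpanIn_refl,
    map_slotIso_lineSpanIn] at h
  have h' := lineSpanIn_refl (𝕜 := 𝕜) ((fun _ => ()) ∘ Finite.equivFin ι) fun _ _ => (0 : W)
  rw [lineSpan_unit, ← symTensors_eq_powerSpan] at h'
  exact h' ▸ h

/-- Splitting off a leaf `j` of the tree: the slots outside the group `j` carry the span of the
remaining lines, which contains the point through which the `j`-th line passes. -/
theorem isIteratedVeroneseProductSubspace_lineSpan {W : Type u} [AddCommGroup W] [Module 𝕜 W]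
    (hW : finrank 𝕜 W = 2) {ι κ : Type} [Finite ι] [Finite κ] [Nonempty κ] (g : ι → κ)
    (hg : Function.Surjective g) (a : κ → κ → W) (ha : ∀ j r, r ≠ j → a j r ≠ 0)
    (htree : IsTreelike 𝕜 (fun j r => a j r)) :
    IsIteratedVeroneseProductSubspace (U := fun _ : ι => W)
      (lineSpan 𝕜 g (fun j i => a j (g i))) := by
  induction hn : Nat.card κ using Nat.strong_induction_on generalizing ι κ with
  | _ n ih =>
  subst hn
  have : Nonempty ι := hg.nonempty
  obtain h1 | h2 : Nat.card κ = 1 ∨ 2 ≤ Nat.card κ := by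
    have := Nat.card_pos (α := κ)
    omega
  · have : Subsingleton κ := (Nat.card_eq_one_iff_unique.1 h1).1
    have : Unique κ := uniqueOfSubsingleton (Classical.arbitrary κ)
    rw [lineSpan_unit, ← symTensors_eq_powerSpan]
    exact isIteratedVeroneseProductSubspace_symTensors hW
  obtain ⟨j, hleaf, i₀, hi₀, hinc⟩ := htree.exists_leaf h2
  let p : ι → Prop := fun i => g i ≠ j
  let g₁ : {i // p i} → {r // r ≠ j} := fun i => ⟨g i, i.2⟩
  have hg₁ : Function.Surjective g₁ := by
    rintro ⟨r, hr⟩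
    obtain ⟨i, rfl⟩ := hg r
    exact ⟨⟨i, hr⟩, rfl⟩
  have hcard : Nat.card {r // r ≠ j} < Nat.card κ := Finite.card_subtype_lt (x := j) (by simp)
  have : Nonempty {r // r ≠ j} := ⟨⟨i₀, hi₀⟩⟩
  have hQ := ih _ hcard g₁ hg₁ (fun r s => a r s)
    (fun r s hrs => ha r s (Subtype.coe_ne_coe.2 hrs)) (htree.restrict _) rfl
  have : Nonempty {i // ¬ p i} := by
    obtain ⟨i, hi⟩ := hg j
    exact ⟨⟨i, not_not.2 hi⟩⟩
  have hK := isIteratedVeroneseProductSubspace_symTensors (𝕜 := 𝕜) (ι := {i // ¬ p i}) hW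
  let Q := lineSpan 𝕜 g₁ fun (r : {r // r ≠ j}) i => a r (g i)
  let s : {i // p i} → W := fun i => a j (g i)
  let t : {i // ¬ p i} → W := fun _ => a i₀ j
  let g' : {i // p i} ⊕ {i // ¬ p i} → κ := Sum.elim (fun i => g i) fun i => g i
  have hsQ : PiTensorProduct.tprod 𝕜 s ∈ Q := by
    refine Parallel.mem (Parallel.tprod fun i => ?_) (tprod_lineVec_mem g₁ _ ⟨i₀, hi₀⟩ (a j i₀))
    by_cases h : g i = i₀
    · rw [lineVec_of_eq (Subtype.ext h)]
      simp only [s, h]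
      exact Parallel.refl _
    · rw [lineVec_of_ne (fun h' => h (congrArg Subtype.val h'))]
      exact hinc _ h i.2
  have htK : PiTensorProduct.tprod 𝕜 t ∈ symTensors 𝕜 {i // ¬ p i} W := by
    rw [symTensors_eq_powerSpan]
    exact Submodule.subset_span ⟨a i₀ j, rfl⟩
  have hSQ : Submodule.span 𝕜 {PiTensorProduct.tprod 𝕜 s} ≤ Q :=
    (Submodule.span_singleton_le_iff_mem _ _).2 hsQ
  have hTK : Submodule.span 𝕜 {PiTensorProduct.tprod 𝕜 t} ≤ symTensors 𝕜 {i // ¬ p i} W :=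
    (Submodule.span_singleton_le_iff_mem _ _).2 htK
  have hP := IsIteratedVeroneseProductSubspace.product (𝕜 := 𝕜)
    (U := fun _ : {i // p i} ⊕ {i // ¬ p i} => W) Q _ (symTensors 𝕜 {i // ¬ p i} W) _ hQ hK
    hSQ ⟨s, fun i => ha j _ i.2, rfl⟩ hTK ⟨t, fun _ => ha i₀ j hi₀.symm, rfl⟩
  have hj : ∀ x, PiTensorProduct.tprod 𝕜 (lineVec g' (fun r i => a r (g' i)) j x) =
      tensorMul 𝕜 (fun _ => W) (PiTensorProduct.tprod 𝕜 s)
        (PiTensorProduct.tprod 𝕜 fun _ : {i // ¬ p i} => x) := by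
    intro x
    rw [← tensorMul_tprod]
    congr 2
    · congr 1
      funext i
      exact lineVec_of_ne (g := g') (i := .inl i) i.2
    · funext i
      exact lineVec_of_eq (g := g') (i := .inr i) (not_not.1 i.2)
  have hr : ∀ (r : {r // r ≠ j}) x,
      Parallel 𝕜 (PiTensorProduct.tprod 𝕜 (lineVec g' (fun r i => a r (g' i)) r x))
      (tensorMul 𝕜 (fun _ => W)
        (PiTensorProduct.tprod 𝕜 (lineVec g₁ (fun (r : {r // r ≠ j}) i => a r (g i)) r x))
        (PiTensorProduct.tprod 𝕜 t)) := by
    intro r x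
    let f : {i // p i} ⊕ {i // ¬ p i} → W :=
      Sum.elim (lineVec g₁ (fun (r : {r // r ≠ j}) i => a r (g i)) r x) t
    have h := tensorMul_tprod 𝕜 (fun _ => W) f
    refine Eq.subst (motive := fun z => Parallel 𝕜 _ z) h.symm (Parallel.tprod ?_)
    rintro (i | i)
    · refine Eq.subst (motive := fun z => Parallel 𝕜 _ z) ?_ (Parallel.refl _)
      change lineVec g' _ r x (.inl i) = lineVec g₁ (fun (r : {r // r ≠ j}) i => a r (g i)) r x i
      by_cases h : g i = r
      · rw [lineVec_of_eq (g := g') (i := .inl i) h, lineVec_of_eq (g := g₁) (Subtype.ext h)]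
      · rw [lineVec_of_ne (g := g') (i := .inl i) h,
          lineVec_of_ne (g := g₁) (fun h' => h (congrArg Subtype.val h'))]
        rfl
    · have hi : g i = j := not_not.1 i.2
      rw [lineVec_of_ne (g := g') (i := .inr i) fun h => r.2 (h.symm.trans hi)]
      refine Eq.subst (motive := fun z => Parallel 𝕜 (a r z) _) hi.symm ?_
      exact hleaf r i₀ r.2 hi₀
  have heq : Submodule.map₂ (tensorMul 𝕜 fun _ => W) Q
        (Submodule.span 𝕜 {PiTensorProduct.tprod 𝕜 t}) ⊔
      Submodule.map₂ (tensorMul 𝕜 fun _ => W) (Submodule.span 𝕜 {PiTensorProduct.tprod 𝕜 s})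
        (symTensors 𝕜 {i // ¬ p i} W) = lineSpan 𝕜 g' fun r i => a r (g' i) := by
    refine le_antisymm (sup_le ?_ ?_) ?_
    · rw [Submodule.map₂_span_singleton_eq_map_flip, Submodule.map_le_iff_le_comap]
      refine Submodule.span_le.2 ?_
      rintro _ ⟨⟨r, x⟩, rfl⟩
      exact (hr r x).mem (tprod_lineVec_mem _ _ _ _)
    · rw [Submodule.map₂_span_singleton_eq_map, Submodule.map_le_iff_le_comap,
        symTensors_eq_powerSpan, powerSpan, Submodule.span_le]
      rintro _ ⟨x, rfl⟩
      simp only [Submodule.comap_coe, Set.mem_preimage, SetLike.mem_coe]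
      rw [← hj]
      exact tprod_lineVec_mem _ _ _ _
    · rw [lineSpan, Submodule.span_le]
      rintro _ ⟨⟨r, x⟩, rfl⟩
      by_cases hrj : r = j
      · subst hrj
        simp only [SetLike.mem_coe]
        rw [hj]
        refine Submodule.mem_sup_right (Submodule.apply_mem_map₂ _
          (Submodule.mem_span_singleton_self _) ?_)
        rw [symTensors_eq_powerSpan]
        exact Submodule.subset_span ⟨x, rfl⟩
      · refine (hr ⟨r, hrj⟩ x).symm.mem (Submodule.mem_sup_left (Submodule.apply_mem_map₂ _ ?_
          (Submodule.mem_span_singleton_self _)))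
        exact tprod_lineVec_mem _ _ _ _
  rw [heq] at hP
  classical
  have h := IsIteratedVeroneseProductSubspace.iso (U' := fun _ : ι => W) (Equiv.sumCompl p).symm
    (fun _ => LinearEquiv.refl 𝕜 W) _ hP
  rw [← lineSpanIn_refl, map_slotIso_lineSpanIn] at h
  have hgσ : g' ∘ (Equiv.sumCompl p).symm = g := by
    rw [Equiv.comp_symm_eq]
    funext i
    cases i <;> rfl
  have hgσ' : ∀ i, g' ((Equiv.sumCompl p).symm i) = g i := congrFun hgσ
  rw [hgσ] at h
  simp only [hgσ'] at h
  exact (lineSpanIn_refl (𝕜 := 𝕜) g fun r i => a r (g i)) ▸ h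

theorem IsTreeSpan.isIteratedVeroneseProductSubspace {ι : Type} [Finite ι] {U : ι → Type u}
    [∀ i, AddCommGroup (U i)] [∀ i, Module 𝕜 (U i)] {H : Submodule 𝕜 (⨂[𝕜] i, U i)}
    (hH : IsTreeSpan H) : IsIteratedVeroneseProductSubspace H := by
  obtain ⟨κ, _, _, W, _, _, g, a, F, hW, hg, ha, htree, rfl⟩ := hH
  have h := IsIteratedVeroneseProductSubspace.iso (U' := U) (Equiv.refl ι) F _
    (isIteratedVeroneseProductSubspace_lineSpan hW g hg a ha htree)
  rwa [← lineSpanIn_refl, map_slotIso_lineSpanIn] at h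

end Iterated

/-! ### Standard Segre-Veronese structures and presentations -/

section Standard

variable {𝕜 : Type w} [RCLike 𝕜]

theorem svSubspace_eq_lineSpanIn {κ : Type} (d : κ → ℕ) {E : κ → Type u}
    [∀ r, AddCommGroup (E r)] [∀ r, Module 𝕜 (E r)] {W : Type*} [AddCommGroup W] [Module 𝕜 W]
    (F : ∀ r, W ≃ₗ[𝕜] E r) (a : κ → (Σ r, Fin (d r)) → W)
    (Γ : ∀ j, Submodule 𝕜 (⨂[𝕜] s : {s : Σ r, Fin (d r) // s.1 ≠ j}, E s.1.1))
    (hΓ : ∀ j, Γ j = Submodule.span 𝕜 {PiTensorProduct.tprod 𝕜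
      fun s : {s : Σ r, Fin (d r) // s.1 ≠ j} => F s.1.1 (a j s.1)}) :
    svSubspace d E Γ =
      lineSpanIn (U := fun s : Σ r, Fin (d r) => E s.1) Sigma.fst a (fun s => F s.1) := by
  have hins : ∀ j x, (PiTensorProduct.tprod 𝕜 fun s : Σ r, Fin (d r) =>
        F s.1 (lineVec Sigma.fst a j x s)) =
      insGroup 𝕜 d E j (PiTensorProduct.tprod 𝕜 fun _ => F j x)
        (PiTensorProduct.tprod 𝕜 fun s => F s.1.1 (a j s.1)) := by
    intro j x
    refine (insGroup_tprod 𝕜 d E j fun s => F s.1 (lineVec Sigma.fst a j x s)).symm.trans ?_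
    congr 2
    · congr 1
      funext p
      rw [lineVec_of_eq (j := j) (i := (⟨j, p⟩ : Σ r, Fin (d r))) rfl]
    · funext s
      rw [lineVec_of_ne s.2]
  refine le_antisymm (iSup_le fun j => ?_) (lineSpanIn_le fun j x => ?_)
  · rw [hΓ, Submodule.map₂_span_singleton_eq_map_flip, Submodule.map_le_iff_le_comap,
      symTensors_eq_powerSpan, powerSpan, Submodule.span_le]
    rintro _ ⟨y, rfl⟩
    obtain ⟨x, rfl⟩ := (F j).surjective y
    simp only [Submodule.comap_coe, Set.mem_preimage, SetLike.mem_coe, LinearMap.flip_apply]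
    rw [← hins]
    exact tprod_mem_lineSpanIn _ _ _ _ _
  · rw [hins]
    refine Submodule.mem_iSup_of_mem j (Submodule.apply_mem_map₂ _ ?_ ?_)
    · rw [symTensors_eq_powerSpan]
      exact Submodule.subset_span ⟨F j x, rfl⟩
    · rw [hΓ]
      exact Submodule.mem_span_singleton_self _

theorem natCard_sigma_fin {κ : Type} [Fintype κ] (d : κ → ℕ) :
    Nat.card (Σ r, Fin (d r)) = ∑ r, d r := by
  simp [Nat.card_eq_fintype_card]

theorem IsStandardSV.nonempty {κ : Type} [Fintype κ] {d : κ → ℕ} {E : κ → Type u}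
    [∀ r, AddCommGroup (E r)] [∀ r, Module 𝕜 (E r)]
    {Γ : ∀ j, Submodule 𝕜 (⨂[𝕜] s : {s : Σ r, Fin (d r) // s.1 ≠ j}, E s.1.1)}
    (h : IsStandardSV d E Γ) : Nonempty κ := by
  by_contra hκ
  rw [not_nonempty_iff] at hκ
  have h1 := h.finrank_eq
  rw [svSubspace, iSup_of_empty, finrank_bot] at h1
  omega

theorem IsStandardSV.isSegreVeroneseSpan {κ : Type} [Fintype κ] {d : κ → ℕ} {E : κ → Type u}
    [∀ r, AddCommGroup (E r)] [∀ r, Module 𝕜 (E r)]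
    {Γ : ∀ j, Submodule 𝕜 (⨂[𝕜] s : {s : Σ r, Fin (d r) // s.1 ≠ j}, E s.1.1)}
    (h : IsStandardSV d E Γ) (hΓ : ∀ j, IsDecomposableLine (Γ j)) :
    IsSegreVeroneseSpan (U := fun s : Σ r, Fin (d r) => E s.1) (svSubspace d E Γ) := by
  classical
  obtain ⟨r₀⟩ := h.nonempty
  choose γ hγ0 hγ using hΓ
  have F : ∀ r, E r₀ ≃ₗ[𝕜] E r := fun r =>
    have : Module.Finite 𝕜 (E r₀) := Module.finite_of_finrank_pos (by rw [h.finrank_slot]; omega)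
    have : Module.Finite 𝕜 (E r) := Module.finite_of_finrank_pos (by rw [h.finrank_slot]; omega)
    LinearEquiv.ofFinrankEq _ _ ((h.finrank_slot r₀).trans (h.finrank_slot r).symm)
  let a : κ → (Σ r, Fin (d r)) → E r₀ := fun j s =>
    if hs : s.1 ≠ j then (F s.1).symm (γ j ⟨s, hs⟩) else 0
  have ha : ∀ j (s : {s : Σ r, Fin (d r) // s.1 ≠ j}), a j s.1 = (F s.1.1).symm (γ j s) :=
    fun j s => dif_pos s.2
  refine ⟨κ, inferInstance, E r₀, _, _, Sigma.fst, a, fun s => F s.1, h.finrank_slot r₀,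
    fun r => ⟨⟨r, ⟨0, h.pos r⟩⟩, rfl⟩, fun j s hs => ?_, svSubspace_eq_lineSpanIn d F a Γ fun j => ?_,
    ?_⟩
  · rw [ha j ⟨s, hs⟩]
    exact (LinearEquiv.map_ne_zero_iff _).2 (hγ0 j _)
  · rw [hγ]
    congr 3
    funext s
    rw [ha, LinearEquiv.apply_symm_apply]
  · rw [h.finrank_eq, natCard_sigma_fin]

variable {ι : Type} {U : ι → Type u} [∀ i, AddCommGroup (U i)] [∀ i, Module 𝕜 (U i)]
  {𝔥 : Type v} [AddCommGroup 𝔥] [Module 𝕜 𝔥] {φ : 𝔥 →ₗ[𝕜] ⨂[𝕜] i, U i}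

theorem IsDecomposableSegreVeronese.injective_and_isSegreVeroneseSpan
    (h : IsDecomposableSegreVeronese φ) :
    Function.Injective φ ∧ IsSegreVeroneseSpan (LinearMap.range φ) := by
  obtain ⟨κ, _, d, E, _, _, Γ, hst, hΓ, Φ, σ, f, hf⟩ := h
  have hcomp : (slotIso σ f).toLinearMap ∘ₗ φ = svInclusion d E Γ ∘ₗ Φ.toLinearMap :=
    LinearMap.ext hf
  have hmap : (LinearMap.range φ).map (slotIso σ f).toLinearMap = svSubspace d E Γ := by
    rw [← LinearMap.range_comp, hcomp, LinearEquiv.range_comp]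
    exact Submodule.range_subtype _
  refine ⟨fun x y hxy => Φ.injective (Subtype.ext ?_), isSegreVeroneseSpan_of_map_slotIso σ f ?_⟩
  · have hx := hf x
    rw [hxy, hf y] at hx
    exact hx.symm
  · rw [hmap]
    exact hst.isSegreVeroneseSpan hΓ

theorem finrank_powerLine {κ : Type} [Finite κ] (d : κ → ℕ) {E : κ → Type u}
    [∀ r, AddCommGroup (E r)] [∀ r, Module 𝕜 (E r)] {a : κ → ∀ r, E r} (j : κ)
    (ha : ∀ r, r ≠ j → a j r ≠ 0) : finrank 𝕜 (powerLine (𝕜 := 𝕜) d a j) = 1 :=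
  finrank_span_singleton (tprod_ne_zero fun s => ha _ s.2)

theorem exists_isPresentedBy [Finite ι] (hφ : Function.Injective φ)
    (h : IsSegreVeroneseSpan (LinearMap.range φ)) :
    ∃ (κ : Type) (_ : Fintype κ) (d : κ → ℕ) (E : κ → Type u) (_ : ∀ r, AddCommGroup (E r))
      (_ : ∀ r, Module 𝕜 (E r)) (a : κ → ∀ r, E r), IsPresentedBy φ d E a := by
  obtain ⟨κ, _, _, W, _, _, g, a, F, hW, hg, ha, -, hrange⟩ := h.isTreeSpan
  obtain ⟨-, -, -, -, -, -, -, -, -, -, -, -, hdim⟩ := h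
  have := Fintype.ofFinite κ
  let d : κ → ℕ := fun r => Nat.card {i // g i = r}
  let σ : (Σ r, Fin (d r)) ≃ ι :=
    (Equiv.sigmaCongrRight fun r => (Finite.equivFin {i // g i = r}).symm).trans
      (Equiv.sigmaFiberEquiv g)
  have hσ : ∀ s, g (σ s) = s.1 := fun s =>
    ((Finite.equivFin {i // g i = s.1}).symm s.2).2
  let f : ∀ s, U (σ s) ≃ₗ[𝕜] W := fun s => (F (σ s)).symm
  have hmap : (LinearMap.range φ).map (slotIso σ f).toLinearMap =
      svSubspace (𝕜 := 𝕜) d (fun _ => W) (powerLine (𝕜 := 𝕜) d a) := by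
    rw [svSubspace_eq_lineSpanIn d (fun _ => LinearEquiv.refl 𝕜 W) (fun j s => a j s.1)
      (powerLine (𝕜 := 𝕜) (U := fun _ => W) d a) fun j => rfl, hrange, map_slotIso_lineSpanIn]
    have h1 : g ∘ σ = Sigma.fst := funext hσ
    have h2 : (fun (j : κ) (s : Σ r, Fin (d r)) => a j (g (σ s))) = fun j s => a j s.1 := by
      funext j s
      rw [hσ]
    have h3 : (fun s => (F (σ s)).trans (f s)) = fun _ => LinearEquiv.refl 𝕜 W :=
      funext fun s => (F (σ s)).self_trans_symm
    rw [h1, h2, h3]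
  refine ⟨κ, inferInstance, d, fun _ => W, _, _, a, ha, ⟨fun r => ?_, fun _ => hW,
    fun j => finrank_powerLine (𝕜 := 𝕜) d j (ha j), ?_⟩, ?_⟩
  · obtain ⟨i, hi⟩ := hg r
    have : Nonempty {i // g i = r} := ⟨⟨i, hi⟩⟩
    exact Nat.card_pos
  · rw [← hmap, LinearEquiv.finrank_map_eq, hdim, ← natCard_sigma_fin, Nat.card_congr σ]
  · refine ⟨(LinearEquiv.ofInjective φ hφ).trans
      (((slotIso σ f).submoduleMap (LinearMap.range φ)).trans (LinearEquiv.ofEq _ _ hmap)), σ, f,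
      fun x => rfl⟩

theorem IsPresentedBy.isDecomposableSegreVeronese {κ : Type} [Fintype κ] {d : κ → ℕ}
    {E : κ → Type u} [∀ r, AddCommGroup (E r)] [∀ r, Module 𝕜 (E r)] {a : κ → ∀ r, E r}
    (h : IsPresentedBy φ d E a) : IsDecomposableSegreVeronese φ :=
  ⟨κ, inferInstance, d, E, _, _, powerLine (𝕜 := 𝕜) d a, h.2.1,
    fun j => ⟨fun s => a j s.1.1, fun s => h.1 j _ s.2, rfl⟩, h.2.2⟩

theorem IsPresentedBy.isTreelike {κ : Type} [Fintype κ] {d : κ → ℕ}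
    {E : κ → Type u} [∀ r, AddCommGroup (E r)] [∀ r, Module 𝕜 (E r)] {a : κ → ∀ r, E r}
    (h : IsPresentedBy φ d E a) : IsTreelike 𝕜 a := by
  obtain ⟨ha, hst, -⟩ := h
  have hW : finrank 𝕜 (Fin 2 → 𝕜) = 2 := by simp
  have F : ∀ r, (Fin 2 → 𝕜) ≃ₗ[𝕜] E r := fun r =>
    have : Module.Finite 𝕜 (E r) := Module.finite_of_finrank_pos (by rw [hst.finrank_slot]; omega)
    LinearEquiv.ofFinrankEq _ _ (hW.trans (hst.finrank_slot r).symm)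
  let b : κ → (Σ r, Fin (d r)) → Fin 2 → 𝕜 := fun j s => (F s.1).symm (a j s.1)
  have hdim := hst.finrank_eq
  rw [svSubspace_eq_lineSpanIn d F b _ fun j => by simp [powerLine, b], finrank_lineSpanIn,
    ← natCard_sigma_fin] at hdim
  have hb : ∀ j s, s.1 ≠ j → b j s ≠ 0 := fun j s hs =>
    (LinearEquiv.map_ne_zero_iff _).2 (ha j _ hs)
  intro i i' j h1 h2 h3
  have h := parallel_or_parallel hW hb hdim (s := ⟨i, ⟨0, hst.pos i⟩⟩) (s' := ⟨i', ⟨0, hst.pos i'⟩⟩)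
    h1 h2 h3
  refine h.imp (fun h => ?_) fun h => ?_
  · simpa [b] using h.map (F i).toLinearMap
  · simpa [b] using h.map (F i').toLinearMap

end Standard

/-! ### Full-products of Segre structures -/

section Segre

variable {𝕜 : Type w} [RCLike 𝕜]

theorem insSlot_tprod_restrict {κ : Type} [DecidableEq κ] {U : κ → Type u} [∀ i, AddCommGroup (U i)]
    [∀ i, Module 𝕜 (U i)] (j : κ) (x : U j) (f : ∀ i, U i) :
    insSlot 𝕜 U j x (PiTensorProduct.tprod 𝕜 fun i : ({j}ᶜ : Set κ) => f i) =
      PiTensorProduct.tprod 𝕜 (Function.update f j x) := by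
  rw [← insSlot_tprod 𝕜 U j]
  congr 2
  · rw [Function.update_self]
  · funext i
    rw [Function.update_of_ne i.2]

theorem correspondingSegre_eq_span {κ : Type} [DecidableEq κ] {U : κ → Type u} [∀ i, AddCommGroup (U i)]
    [∀ i, Module 𝕜 (U i)] (a : κ → ∀ r, U r) :
    correspondingSegre (𝕜 := 𝕜) a = Submodule.span 𝕜 (Set.range fun p : Σ j, U j =>
      PiTensorProduct.tprod 𝕜 (Function.update (a p.1) p.1 p.2)) := by
  refine le_antisymm (iSup_le fun j => ?_) ?_
  · rw [Submodule.map₂_span_singleton_eq_map_flip, Submodule.map_le_iff_le_comap]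
    intro x _
    rw [Submodule.mem_comap, LinearMap.flip_apply, insSlot_tprod_restrict]
    exact Submodule.subset_span ⟨⟨j, x⟩, rfl⟩
  · rw [Submodule.span_le]
    rintro _ ⟨⟨j, x⟩, rfl⟩
    simp only [SetLike.mem_coe]
    rw [← insSlot_tprod_restrict]
    exact Submodule.mem_iSup_of_mem j (Submodule.apply_mem_map₂ _ trivial
      (Submodule.mem_span_singleton_self _))

theorem card_add_one_le_finrank_correspondingSegre {κ : Type} [Finite κ] [Nonempty κ]
    {U : κ → Type u} [∀ i, AddCommGroup (U i)] [∀ i, Module 𝕜 (U i)]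
    (hU : ∀ i, finrank 𝕜 (U i) = 2) (a : κ → ∀ r, U r) (ha : ∀ j r, r ≠ j → a j r ≠ 0) :
    Nat.card κ + 1 ≤ finrank 𝕜 (correspondingSegre (𝕜 := 𝕜) a) := by
  classical
  have hW : finrank 𝕜 (Fin 2 → 𝕜) = 2 := by simp
  have F : ∀ r, (Fin 2 → 𝕜) ≃ₗ[𝕜] U r := fun r =>
    have : Module.Finite 𝕜 (U r) := Module.finite_of_finrank_pos (by rw [hU]; omega)
    LinearEquiv.ofFinrankEq _ _ (hW.trans (hU r).symm)
  have heq : correspondingSegre (𝕜 := 𝕜) a =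
      lineSpanIn id (fun j r => (F r).symm (a j r)) F := by
    have h : ∀ j x, (fun i => F i (lineVec id (fun j r => (F r).symm (a j r)) j x i)) =
        Function.update (a j) j (F j x) := by
      intro j x
      funext i
      by_cases hi : i = j
      · subst hi
        rw [lineVec_of_eq (g := id) (j := i) (i := i) rfl, Function.update_self]
      · rw [lineVec_of_ne hi, Function.update_of_ne hi, LinearEquiv.apply_symm_apply]
    rw [correspondingSegre_eq_span]
    refine le_antisymm ?_ (lineSpanIn_le fun j x => ?_)
    · rw [Submodule.span_le]
      rintro _ ⟨⟨j, y⟩, rfl⟩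
      obtain ⟨x, rfl⟩ := (F j).surjective y
      simp only [SetLike.mem_coe]
      rw [← h]
      exact tprod_mem_lineSpanIn _ _ _ _ _
    · rw [h]
      exact Submodule.subset_span ⟨⟨j, F j x⟩, rfl⟩
  rw [heq, finrank_lineSpanIn]
  exact card_add_one_le_finrank_lineSpan hW _ _ fun j r hr =>
    (LinearEquiv.map_ne_zero_iff _).2 (ha j r hr)

theorem isDecomposableSegre_correspondingSegre {κ : Type} [Finite κ] [Nonempty κ]
    {U : κ → Type u} [∀ i, AddCommGroup (U i)] [∀ i, Module 𝕜 (U i)]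
    (hU : ∀ i, finrank 𝕜 (U i) = 2) (a : κ → ∀ r, U r) (ha : ∀ j r, r ≠ j → a j r ≠ 0)
    (hle : finrank 𝕜 (correspondingSegre (𝕜 := 𝕜) a) ≤ Nat.card κ + 1) :
    IsDecomposableSegre (correspondingSegre (𝕜 := 𝕜) a) :=
  ⟨hU, ⟨_, fun j => ⟨fun i => a j i, fun i => ha j i i.2, rfl⟩, rfl⟩,
    le_antisymm hle (card_add_one_le_finrank_correspondingSegre hU a ha)⟩

/-- Splitting off a leaf `j` of the tree: all other lines have the same coordinate `q` at `j`, so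
that the span is `q ⊗ Q + U_j ⊗ Γ`, where `Q` is the span of the other lines, and `Γ ≤ Q` because
the `j`-th line meets another one. -/
theorem segreAdmitsFullProduct_correspondingSegre {κ : Type} [Finite κ] [Nonempty κ]
    {U : κ → Type u} [∀ i, AddCommGroup (U i)] [∀ i, Module 𝕜 (U i)]
    (hU : ∀ i, finrank 𝕜 (U i) = 2) (a : κ → ∀ r, U r) (ha : ∀ j r, r ≠ j → a j r ≠ 0)
    (htree : IsTreelike 𝕜 a) : SegreAdmitsFullProduct (correspondingSegre (𝕜 := 𝕜) a) := by
  classical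
  induction hn : Nat.card κ using Nat.strong_induction_on generalizing κ with
  | _ n ih =>
  subst hn
  have hfin : ∀ r, Module.Finite 𝕜 (U r) := fun r =>
    Module.finite_of_finrank_pos (by rw [hU]; omega)
  obtain h1 | h2 : Nat.card κ = 1 ∨ 2 ≤ Nat.card κ := by
    have := Nat.card_pos (α := κ)
    omega
  · refine .one _ (isDecomposableSegre_correspondingSegre hU a ha ?_) h1
    have : Subsingleton κ := (Nat.card_eq_one_iff_unique.1 h1).1
    let j : κ := Classical.arbitrary κ
    have hle : correspondingSegre (𝕜 := 𝕜) a ≤ (⊤ : Submodule 𝕜 (U j)).map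
        ((insSlot 𝕜 U j).flip (PiTensorProduct.tprod 𝕜 fun i : ({j}ᶜ : Set κ) => a j i)) := by
      refine iSup_le fun i => ?_
      obtain rfl : i = j := Subsingleton.elim _ _
      rw [Submodule.map₂_span_singleton_eq_map_flip]
    calc _ ≤ _ := Submodule.finrank_mono hle
      _ ≤ finrank 𝕜 (⊤ : Submodule 𝕜 (U j)) := Submodule.finrank_map_le _ _
      _ = Nat.card κ + 1 := by rw [finrank_top, hU, h1]
  obtain ⟨j, hleaf, i₀, hi₀, hinc⟩ := htree.exists_leaf h2
  have hcard' : Nat.card ({j}ᶜ : Set κ) + 1 = Nat.card κ := by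
    rw [Nat.card_coe_set_eq, Set.ncard_compl, Set.ncard_singleton]
    omega
  have : Nonempty ({j}ᶜ : Set κ) := ⟨⟨i₀, hi₀⟩⟩
  let a' : ({j}ᶜ : Set κ) → ∀ r : ({j}ᶜ : Set κ), U r := fun r s => a r s
  have ha' : ∀ r s, s ≠ r → a' r s ≠ 0 := fun r s hrs => ha r s (Subtype.coe_ne_coe.2 hrs)
  have hQ := ih _ (by omega) (fun i : ({j}ᶜ : Set κ) => hU i) a' ha'
    (htree.restrict fun r => r ∈ ({j}ᶜ : Set κ)) rfl
  have hQdim : finrank 𝕜 (correspondingSegre (𝕜 := 𝕜) a') = Nat.card κ := by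
    rw [← hcard']
    cases hQ with
    | one _ h _ => exact h.2.2
    | inSlot _ h => exact h.2.2
  let γ := PiTensorProduct.tprod 𝕜 fun i : ({j}ᶜ : Set κ) => a j i
  have hγ : γ ∈ correspondingSegre (𝕜 := 𝕜) a' := by
    have hmem : PiTensorProduct.tprod 𝕜 (Function.update (a' ⟨i₀, hi₀⟩) ⟨i₀, hi₀⟩ (a j i₀)) ∈
        correspondingSegre (𝕜 := 𝕜) a' := by
      rw [correspondingSegre_eq_span]
      exact Submodule.subset_span ⟨⟨⟨i₀, hi₀⟩, a j i₀⟩, rfl⟩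
    refine Parallel.mem (Parallel.tprod fun i => ?_) hmem
    obtain rfl | hi := eq_or_ne i ⟨i₀, hi₀⟩
    · rw [Function.update_self]
      exact Parallel.refl _
    · rw [Function.update_of_ne hi]
      exact hinc i (fun h => hi (Subtype.ext h)) i.2
  have hH : correspondingSegre (𝕜 := 𝕜) a =
      Submodule.map₂ (insSlot 𝕜 U j) (Submodule.span 𝕜 {a i₀ j}) (correspondingSegre (𝕜 := 𝕜) a') ⊔
        Submodule.map₂ (insSlot 𝕜 U j) ⊤ (Submodule.span 𝕜 {γ}) := by
    have hr : ∀ (r : ({j}ᶜ : Set κ)) (x : U r),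
        Parallel 𝕜 (PiTensorProduct.tprod 𝕜 (Function.update (a r) r.1 x))
          (insSlot 𝕜 U j (a i₀ j) (PiTensorProduct.tprod 𝕜 (Function.update (a' r) r x))) := by
      intro r x
      have hrest : Function.update (a' r) r x =
          fun i : ({j}ᶜ : Set κ) => Function.update (a r) r.1 x i := by
        funext i
        obtain rfl | hi := eq_or_ne i r
        · rw [Function.update_self, Function.update_self]
        · rw [Function.update_of_ne hi, Function.update_of_ne (Subtype.coe_ne_coe.2 hi)]
      rw [hrest, insSlot_tprod_restrict]
      refine Parallel.tprod fun i => ?_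
      obtain rfl | hi := eq_or_ne i j
      · rw [Function.update_self, Function.update_of_ne (fun h => r.2 h.symm)]
        exact hleaf r i₀ r.2 hi₀
      · rw [Function.update_of_ne hi]
        exact Parallel.refl _
    refine le_antisymm ?_ (sup_le ?_ ?_)
    · rw [correspondingSegre_eq_span a, Submodule.span_le]
      rintro _ ⟨⟨r, x⟩, rfl⟩
      simp only [SetLike.mem_coe]
      obtain rfl | hrj := eq_or_ne r j
      · rw [← insSlot_tprod_restrict]
        exact Submodule.mem_sup_right (Submodule.apply_mem_map₂ _ trivial
          (Submodule.mem_span_singleton_self _))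
      · refine (hr ⟨r, hrj⟩ x).symm.mem (Submodule.mem_sup_left (Submodule.apply_mem_map₂ _
          (Submodule.mem_span_singleton_self _) ?_))
        rw [correspondingSegre_eq_span]
        exact Submodule.subset_span ⟨⟨⟨r, hrj⟩, x⟩, rfl⟩
    · rw [Submodule.map₂_span_singleton_eq_map, Submodule.map_le_iff_le_comap,
        correspondingSegre_eq_span, correspondingSegre_eq_span, Submodule.span_le]
      rintro _ ⟨⟨r, x⟩, rfl⟩
      refine Submodule.mem_comap.2 ((hr r x).mem ?_)
      exact Submodule.subset_span ⟨⟨r.1, x⟩, rfl⟩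
    · exact le_iSup (fun j => Submodule.map₂ (insSlot 𝕜 U j) ⊤ (Submodule.span 𝕜
        {PiTensorProduct.tprod 𝕜 fun i : ({j}ᶜ : Set κ) => a j i})) j
  have hne : insSlot 𝕜 U j (a i₀ j) γ ≠ 0 := by
    rw [insSlot_tprod_restrict]
    refine tprod_ne_zero fun i => ?_
    obtain rfl | hi := eq_or_ne i j
    · rw [Function.update_self]
      exact ha i₀ i hi₀.symm
    · rw [Function.update_of_ne hi]
      exact ha j i hi
  refine .inSlot _ (isDecomposableSegre_correspondingSegre hU a ha ?_) j _ _ _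
    (finrank_span_singleton (ha i₀ j hi₀.symm)) (finrank_span_singleton (v := γ) fun h => hne ?_)
    ((Submodule.span_singleton_le_iff_mem _ _).2 hγ) hQ hH
  · have h := finrank_map₂_sup_add_one_le (insSlot 𝕜 U j) ⊤ (correspondingSegre (𝕜 := 𝕜) a')
      (Submodule.mem_top (x := a i₀ j)) hγ hne
    rw [sup_comm, ← hH, finrank_top, hU, hQdim] at h
    omega
  · rw [h, map_zero]

end Segre

/-! ### Generic intersections -/

section Generic

variable {𝕜 : Type w} [RCLike 𝕜]

theorem exists_equiv_apply_eq {W V : Type*} [AddCommGroup W] [Module 𝕜 W] [AddCommGroup V]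
    [Module 𝕜 V] [Module.Finite 𝕜 V] (ω : W ≃ₗ[𝕜] Dual 𝕜 W) (F : W ≃ₗ[𝕜] Dual 𝕜 V) :
    ∃ G : W ≃ₗ[𝕜] V, ∀ v x, F x (G v) = ω v x := by
  let E : V ≃ₗ[𝕜] Dual 𝕜 W := (evalEquiv 𝕜 V).trans F.dualMap
  have hE : ∀ y x, E y x = F x y := fun y x => rfl
  refine ⟨ω.trans E.symm, fun v x => ?_⟩
  exact (hE _ x).symm.trans (LinearMap.congr_fun (E.apply_symm_apply (ω v)) x)

theorem finrank_eq_one_of_eq_span {ι : Type} {U : ι → Type u} [∀ i, AddCommGroup (U i)]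
    [∀ i, Module 𝕜 (U i)] {t : ⨂[𝕜] i, U i} (ht : t ≠ 0) {H : Submodule 𝕜 (⨂[𝕜] i, U i)}
    (h : H = Submodule.span 𝕜 {t}) : finrank 𝕜 H = 1 := by
  rw [h]
  exact finrank_span_singleton ht

section

variable {ι κ : Type} [Finite ι] {V : ι → Type u} [∀ i, AddCommGroup (V i)]
  [∀ i, Module 𝕜 (V i)] {W : Type*} [AddCommGroup W] [Module 𝕜 W] {ω : W ≃ₗ[𝕜] Dual 𝕜 W}
  (F : ∀ i, W ≃ₗ[𝕜] Dual 𝕜 (V i)) (G : ∀ i, W ≃ₗ[𝕜] V i)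

theorem prodForm_eq_dualDistrib (hG : ∀ i v x, F i x (G i v) = ω v x) (m : ι → W) (t : ⨂[𝕜] _ : ι, W) : prodForm ω m t =
    PiTensorProduct.dualDistrib (PiTensorProduct.congr F t)
      (PiTensorProduct.tprod 𝕜 fun i => G i (m i)) := by
  have := Fintype.ofFinite ι
  have ht : t ∈ Submodule.span 𝕜 (Set.range (PiTensorProduct.tprod 𝕜 (s := fun _ : ι => W))) := by
    rw [PiTensorProduct.span_tprod_eq_top]
    trivial
  induction ht using Submodule.span_induction with
  | mem t ht =>
    obtain ⟨f, rfl⟩ := ht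
    rw [prodForm_tprod, PiTensorProduct.congr_tprod, PiTensorProduct.dualDistrib_apply]
    exact Finset.prod_congr rfl fun i _ => (hG i (m i) (f i)).symm
  | zero => simp only [map_zero, LinearMap.zero_apply]
  | add y z _ _ hy hz => rw [map_add, map_add, map_add, LinearMap.add_apply, hy, hz]
  | smul c y _ hy => rw [map_smul, map_smul, map_smul, LinearMap.smul_apply, hy]

theorem mem_slotAnnihilator_iff {p : ι} {l : ℙ 𝕜 (V p)} {t : ⨂[𝕜] i, Dual 𝕜 (V i)} :
    t ∈ slotAnnihilator p l ↔ ∀ x : ∀ i, V i, x p ∈ l.submodule →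
      PiTensorProduct.dualDistrib t (PiTensorProduct.tprod 𝕜 x) = 0 := by
  rw [slotAnnihilator, Submodule.mem_comap, Submodule.mem_dualAnnihilator]
  refine ⟨fun h x hx => h _ (Submodule.subset_span ⟨x, hx, rfl⟩), fun h y hy => ?_⟩
  induction hy using Submodule.span_induction with
  | mem y hy =>
    obtain ⟨x, hx, rfl⟩ := hy
    exact h x hx
  | zero => exact map_zero _
  | add y z _ _ hy hz => rw [map_add, hy, hz, add_zero]
  | smul c y _ hy => rw [map_smul, hy, smul_zero]

/-- Let the vector `v p` of a generic frame represent the line `l` in the slot `p`. Among the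
tensors of the corresponding basis, only the one belonging to `p` lies in the annihilator of `l`,
and the other coefficients of an element of the annihilator vanish. -/
theorem finrank_lineSpanIn_inf_slotAnnihilator_of_frame [Module.Finite 𝕜 W]
    (hG : ∀ i v x, F i x (G i v) = ω v x) (hω : IsAreaForm ω)
    {g : ι → κ} {a : κ → ι → W} {v : ι → W} {x₀ : W} (hv : IsGenericFrame ω g a v x₀)
    (hdim : finrank 𝕜 (lineSpan 𝕜 g a) = Nat.card ι + 1) (p : ι) (l : ℙ 𝕜 (V p))
    (hl : G p (v p) = l.rep) :
    finrank 𝕜 ↥(lineSpanIn g a F ⊓ slotAnnihilator p l) = 1 := by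
  classical
  have := Fintype.ofFinite ι
  let t₀ : ⨂[𝕜] _ : ι, W := PiTensorProduct.tprod 𝕜 (lineVec g a (g p) (v p))
  have ht₀ : PiTensorProduct.congr F t₀ ≠ 0 := by
    rw [LinearEquiv.map_ne_zero_iff]
    exact (hv.linearIndependent hω (g p)).ne_zero (some p)
  have hmem : PiTensorProduct.congr F t₀ ∈ slotAnnihilator p l := by
    rw [mem_slotAnnihilator_iff]
    intro x hx
    rw [Projectivization.submodule_eq, Submodule.mem_span_singleton] at hx
    obtain ⟨c, hc⟩ := hx
    rw [PiTensorProduct.congr_tprod, PiTensorProduct.dualDistrib_apply]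
    refine Finset.prod_eq_zero (Finset.mem_univ p) ?_
    rw [lineVec_of_eq rfl, ← hc, map_smul, ← hl, hG, hω.self, smul_zero]
  have heq : lineSpanIn g a F ⊓ slotAnnihilator p l =
      Submodule.span 𝕜 {PiTensorProduct.congr F t₀} := by
    refine le_antisymm ?_ ?_
    · rintro _ ⟨⟨t, ht, rfl⟩, htl⟩
      rw [SetLike.mem_coe, ← hv.span_eq hω (g p) hdim, Submodule.mem_span_range_iff_exists_fun] at ht
      obtain ⟨c, hc⟩ := ht
      have hzero : ∀ m : ι → W, m p = v p → prodForm ω m t = 0 := by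
        intro m hm
        rw [prodForm_eq_dualDistrib F G hG]
        refine mem_slotAnnihilator_iff.1 htl _ ?_
        rw [hm, hl, Projectivization.submodule_eq]
        exact Submodule.mem_span_singleton_self _
      obtain ⟨hnone, hsome⟩ := hv.coeff_eq_zero hω (g p) c hc (hzero v rfl)
      have ht' : t = c (some p) • t₀ := by
        rw [← hc, Fintype.sum_option, hnone, zero_smul, zero_add]
        refine Finset.sum_eq_single p (fun q _ hqp => ?_) fun h => absurd (Finset.mem_univ p) h
        rw [hsome (Function.update v q x₀) q (fun i hi => Function.update_of_ne hi _ _)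
          (Function.update_self _ _ _) (hzero _ (Function.update_of_ne hqp.symm _ _)), zero_smul]
      rw [ht', map_smul]
      exact Submodule.smul_mem _ _ (Submodule.mem_span_singleton_self _)
    · rw [Submodule.span_singleton_le_iff_mem]
      exact ⟨⟨t₀, tprod_lineVec_mem g a _ _, rfl⟩, hmem⟩
  exact finrank_eq_one_of_eq_span (U := fun i => Dual 𝕜 (V i)) ht₀ heq

end

/-- The lines excluded in the slot `p` are those which correspond to the vectors `a j p`. -/
theorem eventually_finrank_lineSpanIn_inf_slotAnnihilator {ι κ : Type} [Finite ι] [Finite κ]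
    {V : ι → Type u} [∀ i, AddCommGroup (V i)] [∀ i, Module 𝕜 (V i)]
    [∀ i, Module.Finite 𝕜 (V i)] {W : Type*}
    [AddCommGroup W] [Module 𝕜 W] (hW : finrank 𝕜 W = 2) (g : ι → κ) (a : κ → ι → W)
    (ha : ∀ j i, g i ≠ j → a j i ≠ 0) (F : ∀ i, W ≃ₗ[𝕜] Dual 𝕜 (V i))
    (hdim : finrank 𝕜 (lineSpan 𝕜 g a) = Nat.card ι + 1) (p : ι) :
    ∀ᶠ l : ℙ 𝕜 (V p) in Filter.cofinite,
      finrank 𝕜 ↥(lineSpanIn g a F ⊓ slotAnnihilator p l) = 1 := by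
  have : Module.Finite 𝕜 W := Module.finite_of_finrank_pos (by omega)
  obtain ⟨ω, hω⟩ := exists_isAreaForm hW
  choose G hG using fun i => exists_equiv_apply_eq ω (F i)
  have hfin : (Set.range fun r : {r // g p ≠ r} => Projectivization.mk 𝕜 (G p (a r p))
      ((LinearEquiv.map_ne_zero_iff _).2 (ha r p r.2))).Finite := Set.finite_range _
  rw [Filter.eventually_cofinite]
  refine hfin.subset fun l hl => ?_
  by_contra hbad
  refine hl ?_
  have hGv₀ : G p ((G p).symm l.rep) = l.rep := (G p).apply_symm_apply _
  have hv₀ : (G p).symm l.rep ≠ 0 := (LinearEquiv.map_ne_zero_iff _).2 l.rep_nonzero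
  generalize (G p).symm l.rep = v₀ at hGv₀ hv₀
  have hp : ∀ j, g p ≠ j → ω v₀ (a j p) ≠ 0 := by
    intro j hj h0
    obtain ⟨c, hc, hcv⟩ := hω.parallel hv₀ (ha j p hj) h0
    refine hbad ⟨⟨j, hj⟩, ?_⟩
    rw [← l.mk_rep]
    refine (Projectivization.mk_eq_mk_iff' _ _ _ _ _).2 ⟨c, ?_⟩
    rw [hcv, map_smul, hGv₀]
  obtain ⟨v, x₀, hvp, hv⟩ := exists_isGenericFrame hω g a ha p v₀ hv₀ hp
  exact finrank_lineSpanIn_inf_slotAnnihilator_of_frame F G hG hω hv hdim p l (by rw [hvp, hGv₀])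

theorem isFactorizationStructure_of_isSegreVeroneseSpan {ι : Type} [Finite ι] {V : ι → Type u}
    [∀ i, AddCommGroup (V i)] [∀ i, Module 𝕜 (V i)] (hV : ∀ i, finrank 𝕜 (V i) = 2)
    {𝔥 : Type v} [AddCommGroup 𝔥] [Module 𝕜 𝔥] {φ : 𝔥 →ₗ[𝕜] ⨂[𝕜] i, Dual 𝕜 (V i)}
    (hφ : Function.Injective φ)
    (h : IsSegreVeroneseSpan (U := fun i => Dual 𝕜 (V i)) (LinearMap.range φ)) :
    IsFactorizationStructure φ := by
  obtain ⟨κ, _, W, _, _, g, a, F, hW, hg, ha, hrange, hdim⟩ := h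
  have hfin : ∀ i, Module.Finite 𝕜 (V i) := fun i =>
    Module.finite_of_finrank_pos (by rw [hV]; omega)
  have hfr : finrank 𝕜 (lineSpan 𝕜 g a) = Nat.card ι + 1 := by
    rw [← finrank_lineSpanIn g a F, ← hrange, hdim]
  refine ⟨?_, hV, hφ, ?_, fun p => ?_⟩
  · obtain ⟨r⟩ := nonempty_of_finrank_lineSpan hfr
    exact ⟨(hg r).choose⟩
  · rw [← LinearMap.finrank_range_of_inj hφ]
    exact hdim
  · have h := eventually_finrank_lineSpanIn_inf_slotAnnihilator hW g a ha F hfr p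
    rwa [← hrange] at h

end Generic

end FactStr

theorem theorem2p28 {𝕜 : Type w} [RCLike 𝕜] {ι : Type} [Finite ι] {V : ι → Type u}
    [∀ i, AddCommGroup (V i)] [∀ i, Module 𝕜 (V i)] (hV : ∀ i, finrank 𝕜 (V i) = 2)
    {𝔥 : Type v} [AddCommGroup 𝔥] [Module 𝕜 𝔥] (φ : 𝔥 →ₗ[𝕜] ⨂[𝕜] i, Dual 𝕜 (V i)) :
    (FactStr.IsDecomposableSegreVeronese (U := fun i => Dual 𝕜 (V i)) φ →
      FactStr.IsFactorizationStructure φ ∧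
        FactStr.AdmitsFullProduct (U := fun i => Dual 𝕜 (V i)) φ) ∧
    (FactStr.IsDecomposableSegreVeronese (U := fun i => Dual 𝕜 (V i)) φ ↔
      FactStr.IsIteratedVeroneseProduct (U := fun i => Dual 𝕜 (V i)) φ) := by
  refine ⟨fun h => ?_, fun h => ?_, fun h => ?_⟩
  · obtain ⟨hφ, hspan⟩ := h.injective_and_isSegreVeroneseSpan
    refine ⟨FactStr.isFactorizationStructure_of_isSegreVeroneseSpan hV hφ hspan,
      FactStr.exists_isPresentedBy hφ hspan, ?_⟩
    intro κ _ d E _ _ a ha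
    have hκ : Nonempty κ := ha.2.1.nonempty
    exact FactStr.segreAdmitsFullProduct_correspondingSegre ha.2.1.finrank_slot a ha.1 ha.isTreelike
  · obtain ⟨hφ, hspan⟩ := h.injective_and_isSegreVeroneseSpan
    exact ⟨hφ, hspan.isTreeSpan.isIteratedVeroneseProductSubspace⟩
  · obtain ⟨hφ, hspan⟩ := h
    obtain ⟨κ, _, d, E, _, _, a, ha⟩ := FactStr.exists_isPresentedBy hφ
      (FactStr.isSegreVeroneseSpan_of_isIteratedVeroneseProductSubspace hspan).2
    exact ha.isDecomposableSegreVeronese
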